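/- For $n\ge 0$ let $\Diamond_n=\operatorname{conv}(\pm e_1,\ldots,\pm e_n)\subset\mathbb{R}^n$ be the standard crosspolytope and $\triangle_n=\operatorname{conv}(0,e_1,\ldots,e_n)\subset\mathbb{R}^n$ the standard simplex. For convex polytopes $P$ and $Q$, the set $\operatorname{Hom}(P,Q)$ of affine maps $P\to Q$ is a convex polytope in the real vector space of affine maps from the affine hull of $P$ to the ambient space of $Q$. Let $\operatorname{vert}(P,Q)$ be its set of vertices, and let $\operatorname{vert}^{(k)}(P,Q)$ be the set of those $f\in\operatorname{vert}(P,Q)$ whose image $f(P)$ has dimension $k$. Let $\sigma(m,n)$ be the number of maps $f:\{1,\ldots,m\}\to\{\pm1,\ldots,\pm n\}$ with $\{|f(1)|,\ldots,|f(m)|\}=\{1,\ldots,n\}$. Then for all integers $m,n\ge 2$ the sets $\operatorname{vert}(\Diamond_m,\Diamond_n)$ and $\operatorname{vert}^{(k)}(\Diamond_m,\triangle_k)$, $4\le k\le\min(m,n-1)$, are finite and $$ \#\operatorname{vert}(\Diamond_m,\Diamond_n)=2^m n^m+2n+2^{m+1}n(n-1)+16\binom{n}{4}\sigma(m,3)+\sum_{k=4}^{\min(m,n-1)}2^{k+1}\binom{n}{k+1}\cdot\#\operatorname{vert}^{(k)}(\Diamond_m,\triangle_k),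 $$ where the sum is empty if $\min(m,n-1)<4$. -/

import Mathlib

/-- The standard crosspolytope `conv (± e₁, …, ± eₙ)` in `ℝⁿ`. -/
def crosspolytope (n : ℕ) : Set (Fin n → ℝ) :=
  convexHull ℝ
    (Set.range (fun i : Fin n => (Pi.single i 1 : Fin n → ℝ)) ∪
      Set.range (fun i : Fin n => -(Pi.single i 1 : Fin n → ℝ)))

/-- The standard simplex `conv (0, e₁, …, eₙ)` in `ℝⁿ`. -/
def cornerSimplex (n : ℕ) : Set (Fin n → ℝ) :=
  convexHull ℝ (insert 0 (Set.range (fun i : Fin n => (Pi.single i 1 : Fin n → ℝ))))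

/-- The hom-polytope `Hom (P, Q)` of all affine maps `P → Q`, for a polytope `P` that affinely
spans its ambient space `ℝᵐ`, as a convex subset of the real vector space of affine maps
`ℝᵐ → ℝⁿ`. Since `P` spans, an affine map `P → Q` is the restriction of exactly one affine map of
the ambient spaces, with which it is identified. -/
def homPolytope {m n : ℕ} (P : Set (Fin m → ℝ)) (Q : Set (Fin n → ℝ)) :
    Set ((Fin m → ℝ) →ᵃ[ℝ] (Fin n → ℝ)) :=
  {f | Set.MapsTo f P Q}

/-- `vert (P, Q)`: the vertices of the hom-polytope `Hom (P, Q)`. -/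
def vertexMaps {m n : ℕ} (P : Set (Fin m → ℝ)) (Q : Set (Fin n → ℝ)) :
    Set ((Fin m → ℝ) →ᵃ[ℝ] (Fin n → ℝ)) :=
  Set.extremePoints ℝ (homPolytope P Q)

/-- The rank of an affine map: the dimension of its image. -/
noncomputable def affineRank {m n : ℕ} (f : (Fin m → ℝ) →ᵃ[ℝ] (Fin n → ℝ)) : ℕ :=
  Module.finrank ℝ (LinearMap.range f.linear)

/-- `vert⁽ᵏ⁾ (P, Q)`: the vertices of `Hom (P, Q)` that have rank `k`. -/
def vertexMapsOfRank {m n : ℕ} (k : ℕ) (P : Set (Fin m → ℝ)) (Q : Set (Fin n → ℝ)) :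
    Set ((Fin m → ℝ) →ᵃ[ℝ] (Fin n → ℝ)) :=
  {f | f ∈ vertexMaps P Q ∧ affineRank f = k}

/-- `σ (m, n)`: the number of maps `f : {1, …, m} → {± 1, …, ± n}` with
`{|f 1|, …, |f m|} = {1, …, n}`. -/
noncomputable def signedSurjCount (m n : ℕ) : ℕ :=
  Set.ncard {f : Fin m → ℤ | Set.range (fun i => |f i|) = Set.Icc 1 (n : ℤ)}

/-! An affine map `f` on the crosspolytope is recorded by its centre `b = f 0` and directions `aᵢ`,
the images of the basis vectors under the linear part; it maps into a convex `Q` iff all `b ± aᵢ`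
lie in `Q`. The hom-polytope thus becomes an explicit polyhedron (`ballPairs` for the crosspolytope,
`simplexPairs` for the simplex in barycentric coordinates). A point of it is a vertex iff no nonzero
deformation preserves every active constraint, and almost every step exhibits or excludes such a
deformation.

At a vertex of `ballPairs` either `b = 0` or `‖b‖₁ = 1` (`sum_abs_centre_eq_one`). If `b = 0`, each
`aᵢ` is independently some `± eⱼ`, giving `(2n)^m` vertices. Otherwise let `ε` be the sign vector of
`b`. The vertex lies on the face where `∑ εⱼ bⱼ` attains its maximum `1`. That face is linearly
isomorphic to `simplexPairs` on the support of `ε`, and having exactly the sign vector `ε` means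
having a positive barycentric centre. So `ε` contributes `N(k+1)`, the size of `interiorVertices` on
`k+1` coordinates, where `k+1` is the support size, and there are `2^(k+1) * n.choose (k+1)` such
`ε`.

A vertex of the simplex problem has an interior centre iff it has full rank `k`, so `N(k+1)` counts
`vert⁽ᵏ⁾(♢ₘ, △ₖ)`; it vanishes for `k > m`. For small supports, `eq_zero_of_compatible` reduces the
search for vertices to deforming the centre alone, and gives `N(1) = 1`, `N(2) = 2^m`, `N(3) = 0`,
`N(4) = σ(m,3)`. These are the closed terms of the formula. -/

/-! ### Extreme points of polyhedra and their transfer along linear maps -/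

/-- A point of a polyhedron is extreme iff it admits no direction that respects the equations and
stays tight on the active inequalities. -/
theorem mem_extremePoints_polyhedron_iff {E ι κ : Type*} [AddCommGroup E] [Module ℝ E] [Finite ι]
    (e : κ → E →ₗ[ℝ] ℝ) (γ : κ → ℝ) (l : ι → E →ₗ[ℝ] ℝ) (β : ι → ℝ) (x : E) :
    x ∈ Set.extremePoints ℝ {y | (∀ k, e k y = γ k) ∧ ∀ i, l i y ≤ β i} ↔
      ((∀ k, e k x = γ k) ∧ ∀ i, l i x ≤ β i) ∧
        ∀ v, (∀ k, e k v = 0) → (∀ i, l i x = β i → l i v = 0) → v = 0 := by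
  rw [mem_extremePoints]
  refine and_congr_right fun hx => ⟨fun h v hev hlv => ?_, fun h y hy z hz hxyz => ?_⟩
  · have key : ∀ i, ∀ᶠ t : ℝ in nhds 0, l i (x + t • v) ≤ β i := by
      intro i
      rcases (hx.2 i).lt_or_eq with hlt | heq
      · have hc : Continuous fun t : ℝ => l i x + t * l i v := by fun_prop
        have := hc.continuousAt (x := 0)
        have h0 := this.eventually_lt (continuousAt_const (y := β i)) (by simpa using hlt)
        filter_upwards [h0] with t ht
        simpa using ht.le
      · filter_upwards with t
        simp [hlv i heq, heq]
    -- Finiteness of `ι` gives one `ε` valid for all inequalities.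
    have hall := Filter.eventually_all.2 key
    obtain ⟨ε, hε, hball⟩ := Metric.eventually_nhds_iff.1 hall
    have hmem : ∀ t : ℝ, |t| < ε →
        x + t • v ∈ {y | (∀ k, e k y = γ k) ∧ ∀ i, l i y ≤ β i} := fun t ht =>
      ⟨fun k => by simp [hev k, hx.1 k], hball (by simpa using ht)⟩
    have hε2 : |ε / 2| < ε := by rw [abs_of_pos (by positivity)]; linarith
    have := (h _ (hmem (ε / 2) hε2) _ (hmem (-(ε / 2)) (by rwa [abs_neg]))
      ⟨1 / 2, 1 / 2, by norm_num, by norm_num, by norm_num, by module⟩).1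
    have h0 : (ε / 2) • v = 0 := by simpa using this
    exact (smul_eq_zero.1 h0).resolve_left (by positivity)
  · obtain ⟨a, b, ha, hb, hab, rfl⟩ := hxyz
    -- An inequality active at `a • y + b • z` is active at both `y` and `z`, so `y - z` is an
    -- admissible direction.
    have hyz : y - z = 0 := by
      refine h _ (fun k => by simp [hy.1 k, hz.1 k]) fun i hi => ?_
      have h1 := hy.2 i
      have h2 := hz.2 i
      simp only [map_add, map_smul, smul_eq_mul] at hi
      have e1 : a * (β i - l i y) + b * (β i - l i z) = 0 := by
        linear_combination (β i) * hab - hi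
      have p1 := mul_nonneg ha.le (sub_nonneg.2 h1)
      have p2 := mul_nonneg hb.le (sub_nonneg.2 h2)
      have q1 : β i - l i y = 0 :=
        (mul_eq_zero.1 (le_antisymm (by linarith) p1)).resolve_left ha.ne'
      have q2 : β i - l i z = 0 :=
        (mul_eq_zero.1 (le_antisymm (by linarith) p2)).resolve_left hb.ne'
      rw [map_sub]; linarith
    have : y = z := sub_eq_zero.1 hyz
    subst this
    have : y = a • y + b • y := by rw [← add_smul, hab, one_smul]
    exact ⟨this, this⟩

/-- A polyhedron has finitely many extreme points. -/
theorem finite_extremePoints_polyhedron {E ι κ : Type*} [AddCommGroup E] [Module ℝ E] [Finite ι]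
    (e : κ → E →ₗ[ℝ] ℝ) (γ : κ → ℝ) (l : ι → E →ₗ[ℝ] ℝ) (β : ι → ℝ) :
    (Set.extremePoints ℝ {y | (∀ k, e k y = γ k) ∧ ∀ i, l i y ≤ β i}).Finite := by
  refine Set.Finite.of_finite_image (f := fun x => {i | l i x = β i}) (Set.toFinite _) ?_
  intro x hx y hy hxy
  rw [mem_extremePoints_polyhedron_iff] at hx hy
  -- Extreme points with the same active set differ by an admissible direction, so the active set
  -- determines the point.
  refine sub_eq_zero.1 (hx.2 _ (fun k => by simp [hx.1.1 k, hy.1.1 k]) fun i hi => ?_)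
  have hi' : l i y = β i := by
    have h : {i | l i x = β i} = {i | l i y = β i} := hxy
    exact (Set.ext_iff.1 h i).1 hi
  rw [map_sub, hi, hi', sub_self]

/-- A linear map that is injective on a convex set preserves and reflects its extreme points. -/
theorem LinearMap.map_mem_extremePoints_image_iff {E F : Type*} [AddCommGroup E] [Module ℝ E]
    [AddCommGroup F] [Module ℝ F] (f : E →ₗ[ℝ] F) {A : Set E} (hA : Convex ℝ A)
    (hf : Set.InjOn f A) {x : E} (hx : x ∈ A) :
    f x ∈ Set.extremePoints ℝ (f '' A) ↔ x ∈ Set.extremePoints ℝ A := by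
  rw [mem_extremePoints_iff_left, mem_extremePoints_iff_left]
  constructor
  · rintro ⟨-, h⟩
    refine ⟨hx, fun y hy z hz hxyz => hf hy hx (h _ ⟨y, hy, rfl⟩ _ ⟨z, hz, rfl⟩ ?_)⟩
    obtain ⟨a, b, ha, hb, hab, rfl⟩ := hxyz
    exact ⟨a, b, ha, hb, hab, by simp⟩
  · rintro ⟨-, h⟩
    refine ⟨⟨x, hx, rfl⟩, ?_⟩
    rintro _ ⟨y, hy, rfl⟩ _ ⟨z, hz, rfl⟩ ⟨a, b, ha, hb, hab, hxyz⟩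
    have hmem := hA hy hz ha.le hb.le hab
    have : a • y + b • z = x := hf hmem hx (by simpa using hxyz)
    rw [h y hy z hz ⟨a, b, ha, hb, hab, this⟩]

/-! ### The crosspolytope and the simplex by inequalities -/

/-- A point with `∑ |xⱼ| ≤ 1` lies in every convex set containing `0` and those `± eⱼ` for which
the `j`-th coordinate of `x` has the corresponding sign. -/
theorem Convex.mem_of_sum_abs_le_one {ι : Type*} [Fintype ι] [DecidableEq ι] {s : Set (ι → ℝ)}
    (hs : Convex ℝ s) (h0 : (0 : ι → ℝ) ∈ s) {x : ι → ℝ} (hx : ∑ j, |x j| ≤ 1)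
    (hpos : ∀ j, 0 ≤ x j → Pi.single j 1 ∈ s) (hneg : ∀ j, x j < 0 → -Pi.single j 1 ∈ s) :
    x ∈ s := by
  -- The weight `1 - ∑ |xⱼ|` left over goes to the origin, indexed by `none`.
  have key := hs.sum_mem (t := Finset.univ)
    (w := fun o : Option ι => o.elim (1 - ∑ j, |x j|) fun j => |x j|)
    (z := fun o : Option ι => o.elim 0 fun j => if 0 ≤ x j then Pi.single j 1 else -Pi.single j 1)
    (by
      rintro (_ | j) -
      · simpa using hx
      · exact abs_nonneg _)
    (by simp [Fintype.sum_option])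
    (by
      rintro (_ | j) -
      · exact h0
      · by_cases h : 0 ≤ x j
        · simpa [h] using hpos j h
        · simpa [h] using hneg j (not_le.1 h))
  convert key using 1
  rw [Fintype.sum_option]
  simp only [Option.elim_none, smul_zero, zero_add, Option.elim_some]
  have : ∀ j, |x j| • (if 0 ≤ x j then Pi.single j 1 else -Pi.single j 1 : ι → ℝ) =
      Pi.single j (x j) := by
    intro j
    split_ifs with h
    · rw [abs_of_nonneg h, ← Pi.single_smul']; simp
    · rw [abs_of_neg (not_le.1 h), neg_smul_neg, ← Pi.single_smul']; simp
  simp_rw [this]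
  exact (Finset.univ_sum_single x).symm

theorem convex_sum_abs_le_one {ι : Type*} [Fintype ι] : Convex ℝ {x : ι → ℝ | ∑ j, |x j| ≤ 1} := by
  intro x hx y hy a b ha hb hab
  simp only [Set.mem_ofPred_eq] at *
  calc ∑ j, |(a • x + b • y) j| ≤ ∑ j, (a * |x j| + b * |y j|) := by
        refine Finset.sum_le_sum fun j _ => ?_
        simp only [Pi.add_apply, Pi.smul_apply, smul_eq_mul]
        refine (abs_add_le _ _).trans_eq ?_
        rw [abs_mul, abs_mul, abs_of_nonneg ha, abs_of_nonneg hb]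
    _ = a * ∑ j, |x j| + b * ∑ j, |y j| := by
        rw [Finset.sum_add_distrib, Finset.mul_sum, Finset.mul_sum]
    _ ≤ a * 1 + b * 1 := by gcongr
    _ = 1 := by linarith

/-- The origin is the midpoint of `± e₀`. This needs `0 < n`: for `n = 0` the hull is empty while
the ball is a point. -/
theorem crosspolytope_eq {n : ℕ} (hn : 0 < n) :
    crosspolytope n = {x | ∑ j, |x j| ≤ 1} := by
  have hs : ∀ j : Fin n, ∑ k, |(Pi.single j 1 : Fin n → ℝ) k| = 1 := by
    intro j
    rw [Finset.sum_eq_single j] <;> simp +contextual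
  apply Set.Subset.antisymm
  · refine convexHull_min ?_ convex_sum_abs_le_one
    rintro _ (⟨j, rfl⟩ | ⟨j, rfl⟩)
    · exact (hs j).le
    · simpa only [Set.mem_ofPred_eq, Pi.neg_apply, abs_neg] using (hs j).le
  · intro x hx
    have hp : ∀ j : Fin n, (Pi.single j 1 : Fin n → ℝ) ∈ crosspolytope n := fun j =>
      subset_convexHull _ _ (Or.inl ⟨j, rfl⟩)
    have hm : ∀ j : Fin n, -(Pi.single j 1 : Fin n → ℝ) ∈ crosspolytope n := fun j =>
      subset_convexHull _ _ (Or.inr ⟨j, rfl⟩)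
    have hc : Convex ℝ (crosspolytope n) := convex_convexHull _ _
    refine hc.mem_of_sum_abs_le_one ?_ hx (fun j _ => hp j) fun j _ => hm j
    have := hc (hp ⟨0, hn⟩) (hm ⟨0, hn⟩) (by norm_num : (0 : ℝ) ≤ 1 / 2)
      (by norm_num : (0 : ℝ) ≤ 1 / 2) (by norm_num)
    simpa using this

theorem cornerSimplex_eq (n : ℕ) :
    cornerSimplex n = {x | (∀ j, 0 ≤ x j) ∧ ∑ j, x j ≤ 1} := by
  apply Set.Subset.antisymm
  · refine convexHull_min ?_ ?_
    · rintro _ (rfl | ⟨j, rfl⟩)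
      · simp
      · refine ⟨fun k => ?_, by simp⟩
        by_cases h : k = j
        · subst h; simp
        · simp [h]
    · intro x hx y hy a b ha hb hab
      refine ⟨fun j => ?_, ?_⟩
      · have := hx.1 j
        have := hy.1 j
        simp only [Pi.add_apply, Pi.smul_apply, smul_eq_mul]
        positivity
      · calc ∑ j, (a • x + b • y) j = a * ∑ j, x j + b * ∑ j, y j := by
              simp [Finset.sum_add_distrib, Finset.mul_sum]
          _ ≤ a * 1 + b * 1 := by gcongr; exacts [hx.2, hy.2]
          _ = 1 := by linarith
  · rintro x ⟨hx0, hx⟩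
    have hc : Convex ℝ (cornerSimplex n) := convex_convexHull _ _
    refine hc.mem_of_sum_abs_le_one (subset_convexHull _ _ (Set.mem_insert _ _)) ?_
      (fun j _ => subset_convexHull _ _ (Set.mem_insert_of_mem _ ⟨j, rfl⟩))
      fun j hj => absurd (hx0 j) (not_le.2 hj)
    simpa only [abs_of_nonneg (hx0 _)] using hx

/-! ### Affine maps as a centre with directions -/

/-- An affine map `ℝᵐ → ℝⁿ` is given by its value at `0` and the images of the basis vectors under
its linear part. -/
noncomputable def affineMapEquiv (m n : ℕ) :
    ((Fin m → ℝ) →ᵃ[ℝ] (Fin n → ℝ)) ≃ₗ[ℝ] (Fin n → ℝ) × (Fin m → Fin n → ℝ) :=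
  (AffineMap.toConstProdLinearMap ℝ).trans
    (LinearEquiv.prodCongr (LinearEquiv.refl ℝ _) ((Pi.basisFun ℝ (Fin m)).constr ℝ).symm)

@[simp] theorem affineMapEquiv_fst {m n : ℕ} (f : (Fin m → ℝ) →ᵃ[ℝ] (Fin n → ℝ)) :
    (affineMapEquiv m n f).1 = f 0 := rfl

@[simp] theorem affineMapEquiv_snd {m n : ℕ} (f : (Fin m → ℝ) →ᵃ[ℝ] (Fin n → ℝ)) (i : Fin m) :
    (affineMapEquiv m n f).2 i = f.linear (Pi.single i 1) := by
  simp [affineMapEquiv, Module.Basis.constr]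

theorem mapsTo_crosspolytope_iff {m n : ℕ} {Q : Set (Fin n → ℝ)} (hQ : Convex ℝ Q)
    (f : (Fin m → ℝ) →ᵃ[ℝ] (Fin n → ℝ)) :
    Set.MapsTo f (crosspolytope m) Q ↔
      ∀ i, (affineMapEquiv m n f).1 + (affineMapEquiv m n f).2 i ∈ Q ∧
        (affineMapEquiv m n f).1 - (affineMapEquiv m n f).2 i ∈ Q := by
  have hf : ∀ v, f v = f 0 + f.linear v := fun v => by
    have := f.map_vadd 0 v
    simp only [vadd_eq_add, add_zero] at this
    rw [this, add_comm]
  simp only [affineMapEquiv_fst, affineMapEquiv_snd]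
  have e1 : ∀ i : Fin m, f 0 + f.linear (Pi.single i 1) = f (Pi.single i 1) := fun i => (hf _).symm
  have e2 : ∀ i : Fin m, f 0 - f.linear (Pi.single i 1) = f (-Pi.single i 1) := fun i => by
    rw [hf (-_), map_neg, sub_eq_add_neg]
  simp only [e1, e2]
  constructor
  · exact fun h i => ⟨h (subset_convexHull _ _ (Or.inl ⟨i, rfl⟩)),
      h (subset_convexHull _ _ (Or.inr ⟨i, rfl⟩))⟩
  · intro h
    refine convexHull_min ?_ (hQ.affine_preimage f)
    rintro _ (⟨i, rfl⟩ | ⟨i, rfl⟩)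
    · exact (h i).1
    · exact (h i).2

theorem image_vertexMaps {m n : ℕ} {Q : Set (Fin n → ℝ)} (hQ : Convex ℝ Q) :
    affineMapEquiv m n '' vertexMaps (crosspolytope m) Q =
      Set.extremePoints ℝ {x : (Fin n → ℝ) × (Fin m → Fin n → ℝ) |
        ∀ i, x.1 + x.2 i ∈ Q ∧ x.1 - x.2 i ∈ Q} := by
  rw [vertexMaps, image_extremePoints]
  congr 1
  ext x
  constructor
  · rintro ⟨f, hf, rfl⟩
    exact (mapsTo_crosspolytope_iff hQ f).1 hf
  · intro hx
    refine ⟨(affineMapEquiv m n).symm x, ?_, by simp⟩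
    exact (mapsTo_crosspolytope_iff hQ _).2 (by simpa using hx)

/-! ### The two polyhedra and their vertex criteria -/

/-- Tuples `(b, a)` such that all `b ± aᵢ` lie in the `ℓ¹` unit ball. -/
def ballPairs (m : ℕ) (J : Type*) [Fintype J] : Set ((J → ℝ) × (Fin m → J → ℝ)) :=
  {x | ∀ i, ∑ j, |x.1 j + x.2 i j| ≤ 1 ∧ ∑ j, |x.1 j - x.2 i j| ≤ 1}

/-- Tuples `(b, a)` such that all `b ± aᵢ` lie in the standard simplex, in barycentric
coordinates. -/
def simplexPairs (m : ℕ) (J : Type*) [Fintype J] : Set ((J → ℝ) × (Fin m → J → ℝ)) :=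
  {x | ∑ j, x.1 j = 1 ∧ (∀ i, ∑ j, x.2 i j = 0) ∧ ∀ i j, |x.2 i j| ≤ x.1 j}

/-- Extreme points of `simplexPairs` whose centre is interior. -/
def interiorVertices (m : ℕ) (J : Type*) [Fintype J] : Set ((J → ℝ) × (Fin m → J → ℝ)) :=
  {x | x ∈ Set.extremePoints ℝ (simplexPairs m J) ∧ ∀ j, 0 < x.1 j}

section Coordinates

variable {m : ℕ} {J : Type*}

/-- The coordinate `b j`. -/
def centreCoord (m : ℕ) (j : J) : (J → ℝ) × (Fin m → J → ℝ) →ₗ[ℝ] ℝ :=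
  LinearMap.proj j ∘ₗ LinearMap.fst ℝ _ _

/-- The coordinate `a i j`. -/
def dirCoord (i : Fin m) (j : J) : (J → ℝ) × (Fin m → J → ℝ) →ₗ[ℝ] ℝ :=
  LinearMap.proj j ∘ₗ LinearMap.proj i ∘ₗ LinearMap.snd ℝ _ _

@[simp] theorem centreCoord_apply (j : J) (x : (J → ℝ) × (Fin m → J → ℝ)) :
    centreCoord m j x = x.1 j := rfl

@[simp] theorem dirCoord_apply (i : Fin m) (j : J) (x : (J → ℝ) × (Fin m → J → ℝ)) :
    dirCoord i j x = x.2 i j := rfl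

end Coordinates

theorem sign_mul_le_abs (s : SignType) (x : ℝ) : (s : ℝ) * x ≤ |x| := by
  cases s
  · simp
  · simpa using neg_le_abs x
  · simpa using le_abs_self x

/-- Turns the `ℓ¹` ball into finitely many linear inequalities. Sign vectors with zero entries are
redundant but supply further active forms at points with vanishing coordinates. -/
theorem sum_abs_le_one_iff {J : Type*} [Fintype J] (x : J → ℝ) :
    ∑ j, |x j| ≤ 1 ↔ ∀ s : J → SignType, ∑ j, (s j : ℝ) * x j ≤ 1 := by
  refine ⟨fun h s => (Finset.sum_le_sum fun j _ => sign_mul_le_abs _ _).trans h, fun h => ?_⟩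
  simpa only [sign_mul_self] using h fun j => SignType.sign (x j)

section BallPolyhedron

variable (m : ℕ) (J : Type*) [Fintype J]

/-- The linear forms of the inequalities defining `ballPairs`. -/
def ballIneq : (Fin m × (J → SignType)) ⊕ (Fin m × (J → SignType)) →
    ((J → ℝ) × (Fin m → J → ℝ)) →ₗ[ℝ] ℝ :=
  Sum.elim (fun p => ∑ j, (p.2 j : ℝ) • (centreCoord m j + dirCoord p.1 j))
    (fun p => ∑ j, (p.2 j : ℝ) • (centreCoord m j - dirCoord p.1 j))

theorem ballPairs_eq : ballPairs m J =
    {y | (∀ k : Empty, (0 : ((J → ℝ) × (Fin m → J → ℝ)) →ₗ[ℝ] ℝ) y = k.elim) ∧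
      ∀ i, ballIneq m J i y ≤ 1} := by
  ext y
  simp only [ballIneq, ballPairs, sum_abs_le_one_iff, Set.mem_ofPred_eq, IsEmpty.forall_iff,
    true_and, Sum.forall, Prod.forall, Sum.elim_inl, Sum.elim_inr, LinearMap.sum_apply,
    LinearMap.smul_apply, LinearMap.add_apply, LinearMap.sub_apply, centreCoord_apply,
    dirCoord_apply, smul_eq_mul, ← forall_and]

theorem finite_extremePoints_ballPairs : (Set.extremePoints ℝ (ballPairs m J)).Finite := by
  rw [ballPairs_eq]
  exact finite_extremePoints_polyhedron _ _ _ _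

variable {m J}

theorem mem_extremePoints_ballPairs_iff (x : (J → ℝ) × (Fin m → J → ℝ)) :
    x ∈ Set.extremePoints ℝ (ballPairs m J) ↔ x ∈ ballPairs m J ∧
      ∀ v : (J → ℝ) × (Fin m → J → ℝ),
        (∀ i (s : J → SignType), ∑ j, (s j : ℝ) * (x.1 j + x.2 i j) = 1 →
          ∑ j, (s j : ℝ) * (v.1 j + v.2 i j) = 0) →
        (∀ i (s : J → SignType), ∑ j, (s j : ℝ) * (x.1 j - x.2 i j) = 1 →
          ∑ j, (s j : ℝ) * (v.1 j - v.2 i j) = 0) → v = 0 := by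
  have h := mem_extremePoints_polyhedron_iff
    (fun _ : Empty => (0 : ((J → ℝ) × (Fin m → J → ℝ)) →ₗ[ℝ] ℝ)) (fun k => k.elim)
    (ballIneq m J) (fun _ => 1) x
  have hx : ((∀ k : Empty, (0 : ((J → ℝ) × (Fin m → J → ℝ)) →ₗ[ℝ] ℝ) x = k.elim) ∧
      ∀ i, ballIneq m J i x ≤ 1) ↔ x ∈ ballPairs m J := by
    rw [ballPairs_eq]; rfl
  rw [← ballPairs_eq, hx] at h
  rw [h]
  refine and_congr_right fun _ => forall_congr' fun v => ?_
  simp only [ballIneq, IsEmpty.forall_iff, Sum.forall, Prod.forall, Sum.elim_inl, Sum.elim_inr,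
    LinearMap.sum_apply, LinearMap.smul_apply, LinearMap.add_apply, LinearMap.sub_apply,
    centreCoord_apply, dirCoord_apply, smul_eq_mul, forall_const, and_imp]

theorem convex_ballPairs : Convex ℝ (ballPairs m J) := by
  rw [ballPairs_eq]
  rintro x ⟨-, hx2⟩ y ⟨-, hy2⟩ a b ha hb hab
  refine ⟨fun k => k.elim, fun i => ?_⟩
  rw [map_add, map_smul, map_smul, smul_eq_mul, smul_eq_mul]
  calc a * ballIneq m J i x + b * ballIneq m J i y ≤ a * 1 + b * 1 := by
        gcongr
        exacts [hx2 i, hy2 i]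
    _ = 1 := by linarith

end BallPolyhedron

section SimplexPolyhedron

variable (m : ℕ) (J : Type*) [Fintype J]

/-- The linear forms of the equations defining `simplexPairs`. -/
def simplexEq : Option (Fin m) → ((J → ℝ) × (Fin m → J → ℝ)) →ₗ[ℝ] ℝ :=
  fun o => o.elim (∑ j, centreCoord m j) fun i => ∑ j, dirCoord i j

/-- The linear forms of the inequalities defining `simplexPairs`. -/
def simplexIneq :
    (Fin m × J) ⊕ (Fin m × J) → ((J → ℝ) × (Fin m → J → ℝ)) →ₗ[ℝ] ℝ :=
  Sum.elim (fun p => dirCoord p.1 p.2 - centreCoord m p.2)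
    (fun p => -dirCoord p.1 p.2 - centreCoord m p.2)

theorem simplexPairs_eq :
    simplexPairs m J = {y | (∀ k, simplexEq m J k y = k.elim 1 fun _ => 0) ∧
      ∀ i, simplexIneq m J i y ≤ 0} := by
  ext y
  simp only [simplexEq, simplexIneq, simplexPairs, Set.mem_ofPred_eq, Option.forall, Sum.forall,
    Prod.forall, Sum.elim_inl, Sum.elim_inr, LinearMap.sum_apply, LinearMap.neg_apply,
    LinearMap.sub_apply, centreCoord_apply, dirCoord_apply, Option.elim_none, Option.elim_some,
    abs_le, and_assoc, ← forall_and]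
  refine and_congr_right fun _ => forall_congr' fun i => and_congr_right fun _ =>
    forall_congr' fun j => ?_
  constructor <;> rintro ⟨h1, h2⟩ <;> constructor <;> linarith

theorem finite_extremePoints_simplexPairs :
    (Set.extremePoints ℝ (simplexPairs m J)).Finite := by
  rw [simplexPairs_eq]
  exact finite_extremePoints_polyhedron _ _ _ _

variable {m J}

theorem mem_extremePoints_simplexPairs_iff (x : (J → ℝ) × (Fin m → J → ℝ)) :
    x ∈ Set.extremePoints ℝ (simplexPairs m J) ↔ x ∈ simplexPairs m J ∧
      ∀ v : (J → ℝ) × (Fin m → J → ℝ), ∑ j, v.1 j = 0 → (∀ i, ∑ j, v.2 i j = 0) →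
        (∀ i j, x.2 i j = x.1 j → v.2 i j = v.1 j) →
        (∀ i j, x.2 i j = -x.1 j → v.2 i j = -v.1 j) → v = 0 := by
  have h := mem_extremePoints_polyhedron_iff (simplexEq m J) (fun k => k.elim 1 fun _ => 0)
    (simplexIneq m J) (fun _ => 0) x
  have hx : ((∀ k, simplexEq m J k x = k.elim 1 fun _ => 0) ∧ ∀ i, simplexIneq m J i x ≤ 0) ↔
      x ∈ simplexPairs m J := by
    rw [simplexPairs_eq]; rfl
  rw [← simplexPairs_eq, hx] at h
  rw [h]
  refine and_congr_right fun _ => forall_congr' fun v => ?_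
  simp only [simplexEq, simplexIneq, Option.forall, Sum.forall,
    Prod.forall, Sum.elim_inl, Sum.elim_inr, LinearMap.sum_apply, LinearMap.neg_apply,
    LinearMap.sub_apply, centreCoord_apply, dirCoord_apply, Option.elim_none, Option.elim_some,
    and_imp, sub_eq_zero, neg_eq_iff_eq_neg]

theorem finite_interiorVertices : (interiorVertices m J).Finite :=
  (finite_extremePoints_simplexPairs m J).subset fun _ h => h.1

theorem convex_simplexPairs : Convex ℝ (simplexPairs m J) := by
  rw [simplexPairs_eq]
  rintro x ⟨hx1, hx2⟩ y ⟨hy1, hy2⟩ a b ha hb hab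
  refine ⟨fun k => ?_, fun i => ?_⟩
  · rw [map_add, map_smul, map_smul, hx1, hy1, ← add_smul, hab, one_smul]
  · rw [map_add, map_smul, map_smul, smul_eq_mul, smul_eq_mul]
    have := mul_nonpos_of_nonneg_of_nonpos ha (hx2 i)
    have := mul_nonpos_of_nonneg_of_nonpos hb (hy2 i)
    linarith

end SimplexPolyhedron

/-! ### Interior vertices with at most four coordinates -/

section

variable {m : ℕ} {J : Type*} [Fintype J] {x : (J → ℝ) × (Fin m → J → ℝ)}

/-- At a vertex, every direction `aᵢ` has at most one coordinate with `|aᵢⱼ| < bⱼ`. -/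
theorem abs_eq_of_mem_extremePoints (hx : x ∈ Set.extremePoints ℝ (simplexPairs m J)) {i : Fin m}
    {j j' : J} (hj : |x.2 i j| < x.1 j) (hne : j' ≠ j) : |x.2 i j'| = x.1 j' := by
  classical
  rw [mem_extremePoints_simplexPairs_iff] at hx
  by_contra hj'
  have hlt : |x.2 i j'| < x.1 j' := lt_of_le_of_ne (hx.1.2.2 i j') hj'
  have tight : ∀ k, x.2 i k = x.1 k ∨ x.2 i k = -x.1 k → k ≠ j ∧ k ≠ j' := by
    rintro k hk
    have : x.1 k ≤ |x.2 i k| := by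
      rcases hk with hk | hk
      · rw [hk]; exact le_abs_self _
      · rw [hk, abs_neg]; exact le_abs_self _
    constructor <;> rintro rfl <;> linarith
  -- Two slack coordinates of `aᵢ` allow moving along `eⱼ - eⱼ'`, which keeps the coordinate sum.
  have h0 := hx.2 (0, Pi.single i (Pi.single j 1 - Pi.single j' 1)) (by simp)
    (fun k => by
      by_cases hk : k = i
      · subst hk; simp
      · simp [hk])
    (fun k l h => by
      by_cases hk : k = i
      · subst hk; simp [(tight l (Or.inl h)).1, (tight l (Or.inl h)).2]
      · simp [hk])
    (fun k l h => by
      by_cases hk : k = i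
      · subst hk; simp [(tight l (Or.inr h)).1, (tight l (Or.inr h)).2]
      · simp [hk])
  have h1 := congrFun (congrFun (congrArg Prod.snd h0) i) j
  simp [hne.symm] at h1

/-- At an interior vertex the centre admits no deformation compatible with the tight directions. -/
theorem eq_zero_of_compatible (hx : x ∈ interiorVertices m J) {c : J → ℝ} (hc : ∑ j, c j = 0)
    (h : ∀ i (σ : J → ℝ), (∀ j, σ j = 1 ∨ σ j = -1) → (∀ j, x.2 i j = σ j * x.1 j) →
      ∑ j, σ j * c j = 0) : c = 0 := by
  classical
  obtain ⟨hx, hpos⟩ := hx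
  rw [mem_extremePoints_simplexPairs_iff] at hx
  have key : ∀ i, ∃ d : J → ℝ, ∑ j, d j = 0 ∧ (∀ j, x.2 i j = x.1 j → d j = c j) ∧
      ∀ j, x.2 i j = -x.1 j → d j = -c j := by
    intro i
    have e1 : ∀ j, x.2 i j = x.1 j → x.2 i j / x.1 j = 1 := fun j hj => by
      rw [hj, div_self (hpos j).ne']
    have e2 : ∀ j, x.2 i j = -x.1 j → x.2 i j / x.1 j = -1 := fun j hj => by
      rw [hj, neg_div, div_self (hpos j).ne']
    by_cases ht : ∃ j, |x.2 i j| < x.1 j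
    · obtain ⟨k, hk⟩ := ht
      -- On tight coordinates the ratio is the sign `± 1` of the active constraint. The slack
      -- coordinate `k` carries no active constraint, so it can absorb the defect in the sum.
      refine ⟨fun j => x.2 i j / x.1 j * c j -
        (Pi.single k (∑ l, x.2 i l / x.1 l * c l) : J → ℝ) j,
        by simp, fun j hj => ?_, fun j hj => ?_⟩
      · have : j ≠ k := by rintro rfl; rw [hj, abs_of_pos (hpos j)] at hk; exact lt_irrefl _ hk
        simp [this, e1 j hj]
      · have : j ≠ k := by
          rintro rfl; rw [hj, abs_neg, abs_of_pos (hpos j)] at hk; exact lt_irrefl _ hk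
        simp [this, e2 j hj]
    · push Not at ht
      have hall : ∀ j, x.2 i j = x.1 j ∨ x.2 i j = -x.1 j := fun j =>
        (abs_eq (hpos j).le).1 (le_antisymm (hx.1.2.2 i j) (ht j))
      refine ⟨fun j => x.2 i j / x.1 j * c j, h i (fun j => x.2 i j / x.1 j) (fun j => ?_)
        (fun j => ?_), fun j hj => ?_, fun j hj => ?_⟩
      · exact (hall j).imp (e1 j) (e2 j)
      · rw [div_mul_cancel₀ _ (hpos j).ne']
      · simp [e1 j hj]
      · simp [e2 j hj]
  choose d hd0 hd1 hd2 using key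
  exact congrArg Prod.fst (hx.2 (c, d) hc hd0 hd1 hd2)

end

theorem ncard_interiorVertices_one (m : ℕ) : (interiorVertices m (Fin 1)).ncard = 1 := by
  rw [Set.ncard_eq_one]
  refine ⟨(fun _ => 1, fun _ _ => 0), ?_⟩
  ext x
  rw [interiorVertices, Set.mem_ofPred_eq, mem_extremePoints_simplexPairs_iff]
  simp only [Set.mem_ofPred_eq, Set.mem_singleton_iff, simplexPairs, Fin.forall_fin_one,
    Fin.sum_univ_one]
  constructor
  · rintro ⟨⟨⟨h1, h2, -⟩, -⟩, -⟩
    refine Prod.ext (funext fun j => ?_) (funext fun i => funext fun j => ?_)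
    · rw [Subsingleton.elim j 0, h1]
    · rw [Subsingleton.elim j 0, h2]
  · rintro rfl
    refine ⟨⟨⟨rfl, fun _ => rfl, fun _ => by simp⟩, fun v h1 h2 _ _ => ?_⟩, by norm_num⟩
    refine Prod.ext (funext fun j => ?_) (funext fun i => funext fun j => ?_)
    · rw [Subsingleton.elim j 0, h1]; rfl
    · rw [Subsingleton.elim j 0, h2]; rfl

/-- Here `aᵢ = (t, -t)` can be tight in both coordinates only if `b₀ = b₁`; otherwise `(1, -1)`
deforms the centre. With `b = (1/2, 1/2)`, slack in one coordinate would be slack in both, so `t = ±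
1/2`, with free signs. -/
theorem interiorVertices_two {m : ℕ} (hm : 0 < m) :
    interiorVertices m (Fin 2) = Set.range fun s : Fin m → Bool =>
      ((fun _ => 1 / 2, fun i => if s i then ![1 / 2, -(1 / 2)] else ![-(1 / 2), 1 / 2]) :
        (Fin 2 → ℝ) × (Fin m → Fin 2 → ℝ)) := by
  ext x
  constructor
  · intro hx
    have hmem : x ∈ simplexPairs m (Fin 2) := hx.1.1
    obtain ⟨hb, ha, hab⟩ := hmem
    have hpos := hx.2
    simp only [Fin.sum_univ_two] at hb ha
    have heq : x.1 0 = x.1 1 := by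
      by_contra hne
      have h := eq_zero_of_compatible hx (c := ![1, -1]) (by simp) fun i σ hσ hs => by
        have h0 := hs 0
        have h1 := hs 1
        have hi := ha i
        have p0 := hpos 0
        have p1 := hpos 1
        rcases hσ 0 with e0 | e0 <;> rcases hσ 1 with e1 | e1 <;> rw [e0] at h0 <;>
          rw [e1] at h1 <;> first
          | (exfalso; linarith)
          | (exfalso; apply hne; linarith)
      have := congrFun h 0
      simp at this
    have h0 : x.1 0 = 1 / 2 := by linarith
    have h1 : x.1 1 = 1 / 2 := by linarith
    have htight : ∀ i, |x.2 i 0| = 1 / 2 := by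
      intro i
      by_contra hne
      have hlt : |x.2 i 0| < x.1 0 := lt_of_le_of_ne (hab i 0) (by rwa [h0])
      have := abs_eq_of_mem_extremePoints hx.1 hlt (j' := 1) (by decide)
      have e : x.2 i 1 = -x.2 i 0 := by linarith [ha i]
      rw [e, abs_neg, h1] at this
      exact hne this
    refine ⟨fun i => decide (x.2 i 0 = 1 / 2), Prod.ext (funext fun j => ?_)
      (funext fun i => ?_)⟩
    · fin_cases j
      · exact h0.symm
      · exact h1.symm
    · have hi := ha i
      rcases (abs_eq (by norm_num)).1 (htight i) with h | h
      · have e : x.2 i 1 = -(1 / 2) := by linarith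
        ext j
        fin_cases j <;> simp [h, e]
      · have e : x.2 i 1 = 1 / 2 := by linarith
        have hne : ¬ x.2 i 0 = 1 / 2 := by rw [h]; norm_num
        ext j
        fin_cases j <;> simp [h, e] <;> norm_num
  · rintro ⟨s, rfl⟩
    refine ⟨(mem_extremePoints_simplexPairs_iff _).2 ⟨⟨by simp, fun i => ?_, fun i j => ?_⟩,
      fun v hv0 hv h1 h2 => ?_⟩, fun j => by norm_num⟩
    · by_cases h : s i <;> simp [h]
    · by_cases h : s i <;> fin_cases j <;> simp [h, abs_of_pos]
    · have key : ∀ i, (v.2 i 0 = v.1 0 ∧ v.2 i 1 = -v.1 1) ∨ (v.2 i 0 = -v.1 0 ∧ v.2 i 1 = v.1 1) := by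
        intro i
        by_cases h : s i
        · exact Or.inl ⟨h1 i 0 (by simp [h]), h2 i 1 (by simp [h])⟩
        · exact Or.inr ⟨h2 i 0 (by simp [h]), h1 i 1 (by simp [h])⟩
      simp only [Fin.sum_univ_two] at hv0 hv
      have hb : v.1 0 = 0 ∧ v.1 1 = 0 := by
        have := hv ⟨0, hm⟩
        rcases key ⟨0, hm⟩ with ⟨e0, e1⟩ | ⟨e0, e1⟩ <;> constructor <;> linarith
      refine Prod.ext (funext fun j => ?_) (funext fun i => funext fun j => ?_)
      · fin_cases j
        · exact hb.1
        · exact hb.2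
      · rcases key i with ⟨e0, e1⟩ | ⟨e0, e1⟩ <;> fin_cases j <;> simp [e0, e1, hb.1, hb.2]

theorem ncard_interiorVertices_two {m : ℕ} (hm : 0 < m) :
    (interiorVertices m (Fin 2)).ncard = 2 ^ m := by
  rw [interiorVertices_two hm, ← Set.image_univ, Set.ncard_image_of_injective, Set.ncard_univ]
  · simp
  · intro s t hst
    funext i
    have h := congrFun (congrFun (congrArg Prod.snd hst) i) 0
    rcases hs : s i <;> rcases ht : t i <;> simp [hs, ht] at h ⊢ <;> norm_num at h

/-- A fully tight direction makes one centre coordinate the sum of the other two. Positivity permits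
at most one of these equations, which cannot rigidify the two-dimensional space of sum-zero
deformations. -/
theorem interiorVertices_three (m : ℕ) : interiorVertices m (Fin 3) = ∅ := by
  refine Set.eq_empty_of_forall_notMem fun x hx => ?_
  have hmem : x ∈ simplexPairs m (Fin 3) := hx.1.1
  obtain ⟨hb, ha, -⟩ := hmem
  have p0 := hx.2 0
  have p1 := hx.2 1
  have p2 := hx.2 2
  simp only [Fin.sum_univ_three] at hb ha
  have key : ∀ c0 c1 c2 : ℝ, c0 + c1 + c2 = 0 →
      (x.1 0 = x.1 1 + x.1 2 → c0 = c1 + c2) → (x.1 1 = x.1 0 + x.1 2 → c1 = c0 + c2) →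
      (x.1 2 = x.1 0 + x.1 1 → c2 = c0 + c1) → c0 = 0 ∧ c1 = 0 := by
    intro c0 c1 c2 hc k0 k1 k2
    have h := eq_zero_of_compatible hx (c := ![c0, c1, c2])
      (by simpa [Fin.sum_univ_three] using hc) fun i σ hσ hs => by
        have h0 := hs 0
        have h1 := hs 1
        have h2 := hs 2
        have hi := ha i
        simp only [Fin.sum_univ_three, Matrix.cons_val]
        rcases hσ 0 with e0 | e0 <;> rcases hσ 1 with e1 | e1 <;> rcases hσ 2 with e2 | e2 <;>
          rw [e0] at h0 ⊢ <;> rw [e1] at h1 ⊢ <;> rw [e2] at h2 ⊢ <;> first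
          | (exfalso; linarith)
          | linarith [k0 (by linarith)]
          | linarith [k1 (by linarith)]
          | linarith [k2 (by linarith)]
    exact ⟨by simpa using congrFun h 0, by simpa using congrFun h 1⟩
  by_cases q0 : x.1 0 = x.1 1 + x.1 2
  · have := (key 0 1 (-1) (by norm_num) (fun _ => by norm_num) (fun h => by linarith)
      (fun h => by linarith)).2
    norm_num at this
  by_cases q1 : x.1 1 = x.1 0 + x.1 2
  · have := (key 1 0 (-1) (by norm_num) (fun h => absurd h q0) (fun h => by norm_num)
      (fun h => by linarith)).1
    norm_num at this
  · have := (key 1 (-1) 0 (by norm_num) (fun h => absurd h q0) (fun h => absurd h q1)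
      (fun h => by norm_num)).1
    norm_num at this

theorem vecCons_four_two (a b c d : ℝ) : (![a, b, c, d] : Fin 4 → ℝ) 2 = c := rfl

theorem vecCons_four_three (a b c d : ℝ) : (![a, b, c, d] : Fin 4 → ℝ) 3 = d := rfl

/-- The vertices of the octahedron cut out of `∑ⱼ aⱼ = 0` by `|aⱼ| ≤ 1/4`. -/
noncomputable def octahedronVertex (p : ℤ) : Fin 4 → ℝ :=
  if p = 1 then ![1 / 4, 1 / 4, -(1 / 4), -(1 / 4)]
  else if p = -1 then ![-(1 / 4), -(1 / 4), 1 / 4, 1 / 4]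
  else if p = 2 then ![1 / 4, -(1 / 4), 1 / 4, -(1 / 4)]
  else if p = -2 then ![-(1 / 4), 1 / 4, -(1 / 4), 1 / 4]
  else if p = 3 then ![1 / 4, -(1 / 4), -(1 / 4), 1 / 4]
  else ![-(1 / 4), 1 / 4, 1 / 4, -(1 / 4)]

theorem abs_mem_Icc_one_three {p : ℤ} (h : |p| ∈ Set.Icc 1 (3 : ℤ)) :
    p = 1 ∨ p = -1 ∨ p = 2 ∨ p = -2 ∨ p = 3 ∨ p = -3 := by
  obtain ⟨h1, h2⟩ := h
  rcases abs_cases p with ⟨h, _⟩ | ⟨h, _⟩ <;> omega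

/-- Each way of splitting the four coordinates into pairs is realised by some direction of an
interior vertex. -/
theorem exists_direction_of_pairing {m : ℕ} {x : (Fin 4 → ℝ) × (Fin m → Fin 4 → ℝ)}
    (hx : x ∈ interiorVertices m (Fin 4)) (e : Fin 4 ≃ Fin 4) :
    ∃ i, ∃ s : ℝ, (s = 1 ∨ s = -1) ∧ x.2 i (e 0) = s * x.1 (e 0) ∧ x.2 i (e 1) = s * x.1 (e 1) ∧
      x.2 i (e 2) = -(s * x.1 (e 2)) ∧ x.2 i (e 3) = -(s * x.1 (e 3)) := by
  by_contra hno
  push Not at hno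
  have hmem : x ∈ simplexPairs m (Fin 4) := hx.1.1
  obtain ⟨-, ha, -⟩ := hmem
  have p0 := hx.2 (e 0)
  have p1 := hx.2 (e 1)
  have p2 := hx.2 (e 2)
  have p3 := hx.2 (e 3)
  have hsum : ∀ i, x.2 i (e 0) + x.2 i (e 1) + x.2 i (e 2) + x.2 i (e 3) = 0 := fun i => by
    rw [← ha i, ← Equiv.sum_comp e, Fin.sum_univ_four]
  set b0 := x.1 (e 0)
  set b1 := x.1 (e 1)
  set b2 := x.1 (e 2)
  set b3 := x.1 (e 3)
  -- The hypotheses cover every fully tight sign pattern except the one excluded by `hno`: four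
  -- splittings of type one against three, and the other two pairings.
  have key : ∀ c0 c1 c2 c3 : ℝ, c0 + c1 + c2 + c3 = 0 →
      (b0 = b1 + b2 + b3 → c0 = c1 + c2 + c3) → (b1 = b0 + b2 + b3 → c1 = c0 + c2 + c3) →
      (b2 = b0 + b1 + b3 → c2 = c0 + c1 + c3) → (b3 = b0 + b1 + b2 → c3 = c0 + c1 + c2) →
      (b0 + b2 = b1 + b3 → c0 + c2 = c1 + c3) → (b0 + b3 = b1 + b2 → c0 + c3 = c1 + c2) →
      c0 = 0 ∧ c1 = 0 := by
    intro c0 c1 c2 c3 hc k0 k1 k2 k3 k4 k5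
    have h := eq_zero_of_compatible hx (c := ![c0, c1, c2, c3] ∘ e.symm)
      (by rw [← Equiv.sum_comp e]; simpa [Fin.sum_univ_four] using hc) fun i σ hσ hs => by
        have h0 := hs (e 0)
        have h1 := hs (e 1)
        have h2 := hs (e 2)
        have h3 := hs (e 3)
        have hi := hsum i
        have n1 := hno i 1 (Or.inl rfl)
        have n2 := hno i (-1) (Or.inr rfl)
        rw [← Equiv.sum_comp e]
        simp only [Fin.sum_univ_four, Function.comp_apply, Equiv.symm_apply_apply, Matrix.cons_val]
        rcases hσ (e 0) with e0 | e0 <;> rcases hσ (e 1) with e1 | e1 <;>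
          rcases hσ (e 2) with e2 | e2 <;> rcases hσ (e 3) with e3 | e3 <;>
          rw [e0] at h0 ⊢ <;> rw [e1] at h1 ⊢ <;> rw [e2] at h2 ⊢ <;> rw [e3] at h3 ⊢ <;> first
          | (exfalso; linarith)
          | linarith [k0 (by linarith)]
          | linarith [k1 (by linarith)]
          | linarith [k2 (by linarith)]
          | linarith [k3 (by linarith)]
          | linarith [k4 (by linarith)]
          | linarith [k5 (by linarith)]
          | exact absurd (by linarith) (n1 (by linarith) (by linarith) (by linarith))
          | exact absurd (by linarith) (n2 (by linarith) (by linarith) (by linarith))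
    exact ⟨by simpa using congrFun h (e 0), by simpa using congrFun h (e 1)⟩
  -- By positivity, a one-against-three equation excludes all other listed equations. If none holds,
  -- only two pairing equations remain, and `(1, 1, -1, -1)` satisfies both.
  by_cases q0 : b0 = b1 + b2 + b3
  · have := (key 0 1 (-1) 0 (by norm_num) (fun h => by norm_num) (fun h => by linarith)
      (fun h => by linarith) (fun h => by linarith) (fun h => by linarith)
      (fun h => by linarith)).2
    norm_num at this
  by_cases q1 : b1 = b0 + b2 + b3
  · have := (key 1 0 (-1) 0 (by norm_num) (fun h => by linarith) (fun h => by norm_num)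
      (fun h => by linarith) (fun h => by linarith) (fun h => by linarith)
      (fun h => by linarith)).1
    norm_num at this
  by_cases q2 : b2 = b0 + b1 + b3
  · have := (key 1 (-1) 0 0 (by norm_num) (fun h => by linarith) (fun h => by linarith)
      (fun h => by norm_num) (fun h => by linarith) (fun h => by linarith)
      (fun h => by linarith)).1
    norm_num at this
  by_cases q3 : b3 = b0 + b1 + b2
  · have := (key 1 (-1) 0 0 (by norm_num) (fun h => by linarith) (fun h => by linarith)
      (fun h => by linarith) (fun h => by norm_num) (fun h => by linarith)
      (fun h => by linarith)).1
    norm_num at this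
  · have := (key 1 1 (-1) (-1) (by norm_num) (fun h => absurd h q0) (fun h => absurd h q1)
      (fun h => absurd h q2) (fun h => absurd h q3) (fun h => by norm_num)
      (fun h => by norm_num)).1
    norm_num at this

/-- All three pairings occur among the directions, and their equations force `b = (1/4, 1/4, 1/4,
1/4)`. Every direction is then an octahedron vertex: `|p|` is the coordinate paired with coordinate
`0`, the sign of `p` is the sign at coordinate `0`, and the last branch of `octahedronVertex` is the
value at `-3`. Realising all pairings is surjectivity of `|f|` onto `{1, 2, 3}`. -/
theorem interiorVertices_four (m : ℕ) :
    interiorVertices m (Fin 4) = (fun f : Fin m → ℤ =>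
      ((fun _ => 1 / 4, fun i => octahedronVertex (f i)) :
        (Fin 4 → ℝ) × (Fin m → Fin 4 → ℝ))) ''
      {f : Fin m → ℤ | Set.range (fun i => |f i|) = Set.Icc 1 ((3 : ℕ) : ℤ)} := by
  ext x
  constructor
  · intro hx
    have hmem : x ∈ simplexPairs m (Fin 4) := hx.1.1
    obtain ⟨hb, ha, hab⟩ := hmem
    simp only [Fin.sum_univ_four] at hb ha
    -- The three permutations pair coordinate `0` with `1`, `2` and `3` in turn.
    obtain ⟨i1, s1, hs1, q10, q11, q12, q13⟩ := exists_direction_of_pairing hx (Equiv.refl _)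
    obtain ⟨i2, s2, hs2, q20, q21, q22, q23⟩ := exists_direction_of_pairing hx (Equiv.swap 1 2)
    obtain ⟨i3, s3, hs3, q30, q31, q32, q33⟩ := exists_direction_of_pairing hx (Equiv.swap 1 3)
    simp only [Equiv.refl_apply] at q10 q11 q12 q13
    simp only [show Equiv.swap (1 : Fin 4) 2 0 = 0 by decide,
      show Equiv.swap (1 : Fin 4) 2 1 = 2 by decide, show Equiv.swap (1 : Fin 4) 2 2 = 1 by decide,
      show Equiv.swap (1 : Fin 4) 2 3 = 3 by decide] at q20 q21 q22 q23
    simp only [show Equiv.swap (1 : Fin 4) 3 0 = 0 by decide,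
      show Equiv.swap (1 : Fin 4) 3 1 = 3 by decide, show Equiv.swap (1 : Fin 4) 3 2 = 2 by decide,
      show Equiv.swap (1 : Fin 4) 3 3 = 1 by decide] at q30 q31 q32 q33
    have r1 : x.1 0 + x.1 1 = x.1 2 + x.1 3 := by
      have := ha i1
      rcases hs1 with rfl | rfl <;> linarith
    have r2 : x.1 0 + x.1 2 = x.1 1 + x.1 3 := by
      have := ha i2
      rcases hs2 with rfl | rfl <;> linarith
    have r3 : x.1 0 + x.1 3 = x.1 1 + x.1 2 := by
      have := ha i3
      rcases hs3 with rfl | rfl <;> linarith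
    have b0 : x.1 0 = 1 / 4 := by linarith
    have b1 : x.1 1 = 1 / 4 := by linarith
    have b2 : x.1 2 = 1 / 4 := by linarith
    have b3 : x.1 3 = 1 / 4 := by linarith
    have hball : ∀ j, x.1 j = 1 / 4 := by
      intro j; fin_cases j <;> assumption
    have hq : ∀ {t : ℝ}, |t| = 1 / 4 → t = 1 / 4 ∨ t = -(1 / 4) := fun h =>
      (abs_eq (by norm_num)).1 h
    have tight : ∀ i j, |x.2 i j| = 1 / 4 := by
      -- Three entries `± 1/4` sum to an odd multiple of `1/4`, so the remaining entry cannot be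
      -- strictly smaller in absolute value.
      intro i j
      by_contra hne
      have hlt : |x.2 i j| < 1 / 4 := lt_of_le_of_ne ((hab i j).trans_eq (hball j)) hne
      have hoth : ∀ j', j' ≠ j → x.2 i j' = 1 / 4 ∨ x.2 i j' = -(1 / 4) := fun j' hj' => by
        have := abs_eq_of_mem_extremePoints hx.1 (hlt.trans_eq (hball j).symm) hj'
        exact hq (this.trans (hball j'))
      have hi := ha i
      obtain ⟨l1, l2⟩ := abs_lt.1 hlt
      fin_cases j
      · rcases hoth 1 (by decide) with h1 | h1 <;> rcases hoth 2 (by decide) with h2 | h2 <;>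
          rcases hoth 3 (by decide) with h3 | h3 <;> simp at l1 l2 <;> linarith
      · rcases hoth 0 (by decide) with h1 | h1 <;> rcases hoth 2 (by decide) with h2 | h2 <;>
          rcases hoth 3 (by decide) with h3 | h3 <;> simp at l1 l2 <;> linarith
      · rcases hoth 0 (by decide) with h1 | h1 <;> rcases hoth 1 (by decide) with h2 | h2 <;>
          rcases hoth 3 (by decide) with h3 | h3 <;> simp at l1 l2 <;> linarith
      · rcases hoth 0 (by decide) with h1 | h1 <;> rcases hoth 1 (by decide) with h2 | h2 <;>
          rcases hoth 2 (by decide) with h3 | h3 <;> simp at l1 l2 <;> linarith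
    have hex : ∀ i, ∃ p : ℤ, |p| ∈ Set.Icc 1 (3 : ℤ) ∧ octahedronVertex p = x.2 i ∧
        (x.2 i 0 = x.2 i 1 → |p| = 1) ∧ (x.2 i 0 = x.2 i 2 → |p| = 2) ∧
        (x.2 i 0 = x.2 i 3 → |p| = 3) := by
      intro i
      have hi := ha i
      have build : ∀ p : ℤ, ∀ a0 a1 a2 a3 : ℝ, octahedronVertex p = ![a0, a1, a2, a3] →
          x.2 i 0 = a0 → x.2 i 1 = a1 → x.2 i 2 = a2 → x.2 i 3 = a3 →
          octahedronVertex p = x.2 i := by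
        intro p a0 a1 a2 a3 h h0 h1 h2 h3
        rw [h]
        ext j
        fin_cases j <;> simp [*]
      rcases hq (tight i 0) with h0 | h0 <;> rcases hq (tight i 1) with h1 | h1 <;>
        rcases hq (tight i 2) with h2 | h2 <;> rcases hq (tight i 3) with h3 | h3 <;>
        try (exfalso; linarith)
      · exact ⟨1, by norm_num, build _ _ _ _ _ (by simp [octahedronVertex]) h0 h1 h2 h3,
          by norm_num [h0, h1, h2, h3]⟩
      · exact ⟨2, by norm_num, build _ _ _ _ _ (by simp [octahedronVertex]) h0 h1 h2 h3,
          by norm_num [h0, h1, h2, h3]⟩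
      · exact ⟨3, by norm_num, build _ _ _ _ _ (by simp [octahedronVertex]) h0 h1 h2 h3,
          by norm_num [h0, h1, h2, h3]⟩
      · exact ⟨-3, by norm_num, build _ _ _ _ _ (by simp [octahedronVertex]) h0 h1 h2 h3,
          by norm_num [h0, h1, h2, h3]⟩
      · exact ⟨-2, by norm_num, build _ _ _ _ _ (by simp [octahedronVertex]) h0 h1 h2 h3,
          by norm_num [h0, h1, h2, h3]⟩
      · exact ⟨-1, by norm_num, build _ _ _ _ _ (by simp [octahedronVertex]) h0 h1 h2 h3,
          by norm_num [h0, h1, h2, h3]⟩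
    choose f hf1 hf2 hf3 hf4 hf5 using hex
    refine ⟨f, Set.Subset.antisymm ?_ ?_, Prod.ext (funext fun j => (hball j).symm) (funext hf2)⟩
    · rintro _ ⟨i, rfl⟩
      exact hf1 i
    · rintro p ⟨hp1, hp3⟩
      push_cast at hp3
      have : p = 1 ∨ p = 2 ∨ p = 3 := by omega
      rcases this with rfl | rfl | rfl
      · exact ⟨i1, hf3 i1 (by rw [q10, q11, b0, b1])⟩
      · exact ⟨i2, hf4 i2 (by rw [q20, q21, b0, b2])⟩
      · exact ⟨i3, hf5 i3 (by rw [q30, q31, b0, b3])⟩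
  · rintro ⟨f, hf, rfl⟩
    have hf' : Set.range (fun i => |f i|) = Set.Icc 1 (3 : ℤ) := hf
    have hcase : ∀ i, f i = 1 ∨ f i = -1 ∨ f i = 2 ∨ f i = -2 ∨ f i = 3 ∨ f i = -3 := fun i =>
      abs_mem_Icc_one_three (hf' ▸ Set.mem_range_self i)
    refine ⟨(mem_extremePoints_simplexPairs_iff _).2 ⟨⟨by simp, fun i => ?_, fun i j => ?_⟩,
      fun v hv0 hv h1 h2 => ?_⟩, fun j => by norm_num⟩
    · rcases hcase i with h | h | h | h | h | h <;>
        norm_num [h, octahedronVertex, Fin.sum_univ_four, vecCons_four_two,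
          vecCons_four_three]
    · rcases hcase i with h | h | h | h | h | h <;> fin_cases j <;>
        norm_num [h, octahedronVertex, abs_of_pos]
    · simp only [Fin.sum_univ_four] at hv0 hv
      have key : ∀ i, (v.1 = 0 → v.2 i = 0) ∧
          (|f i| = 1 → v.1 0 + v.1 1 = v.1 2 + v.1 3) ∧
          (|f i| = 2 → v.1 0 + v.1 2 = v.1 1 + v.1 3) ∧
          (|f i| = 3 → v.1 0 + v.1 3 = v.1 1 + v.1 2) := by
        intro i
        have hd : ∀ j, (octahedronVertex (f i) j = 1 / 4 → v.2 i j = v.1 j) ∧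
            (octahedronVertex (f i) j = -(1 / 4) → v.2 i j = -v.1 j) := fun j =>
          ⟨h1 i j, h2 i j⟩
        have d0 := hd 0
        have d1 := hd 1
        have d2 := hd 2
        have d3 := hd 3
        have hi := hv i
        rcases hcase i with h | h | h | h | h | h <;>
          norm_num [h, octahedronVertex, vecCons_four_two, vecCons_four_three] at d0 d1 d2 d3 <;>
          rw [d0, d1, d2, d3] at hi <;>
          refine ⟨fun hz => ?_, fun h' => ?_, fun h' => ?_, fun h' => ?_⟩ <;>
          first
          | (ext j; fin_cases j <;> simp [d0, d1, d2, d3, hz])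
          | (exfalso; norm_num [h] at h'; done)
          | linarith
      have hrange : ∀ p ∈ Set.Icc 1 (3 : ℤ), ∃ i, |f i| = p := fun p hp => by
        rw [← hf'] at hp; exact hp
      obtain ⟨i1, hi1⟩ := hrange 1 (by norm_num)
      obtain ⟨i2, hi2⟩ := hrange 2 (by norm_num)
      obtain ⟨i3, hi3⟩ := hrange 3 (by norm_num)
      have r1 := (key i1).2.1 hi1
      have r2 := (key i2).2.2.1 hi2
      have r3 := (key i3).2.2.2 hi3
      have hb : v.1 = 0 := by
        ext j
        fin_cases j <;> simp <;> linarith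
      exact Prod.ext hb (funext fun i => (key i).1 hb)

theorem octahedronVertex_injOn {p q : ℤ} (hp : |p| ∈ Set.Icc 1 (3 : ℤ))
    (hq : |q| ∈ Set.Icc 1 (3 : ℤ)) (h : octahedronVertex p = octahedronVertex q) : p = q := by
  have h0 := congrFun h 0
  have h1 := congrFun h 1
  have h2 := congrFun h 2
  rcases abs_mem_Icc_one_three hp with rfl | rfl | rfl | rfl | rfl | rfl <;>
    rcases abs_mem_Icc_one_three hq with rfl | rfl | rfl | rfl | rfl | rfl <;>
    first
    | rfl
    | (exfalso; norm_num [octahedronVertex, vecCons_four_two, vecCons_four_three] at h0; done)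
    | (exfalso; norm_num [octahedronVertex, vecCons_four_two, vecCons_four_three] at h1; done)
    | (exfalso; norm_num [octahedronVertex, vecCons_four_two, vecCons_four_three] at h2)

theorem ncard_interiorVertices_four (m : ℕ) :
    (interiorVertices m (Fin 4)).ncard = signedSurjCount m 3 := by
  rw [interiorVertices_four, signedSurjCount]
  refine Set.InjOn.ncard_image fun f hf g hg hfg => ?_
  have hf' : Set.range (fun i => |f i|) = Set.Icc 1 (3 : ℤ) := hf
  have hg' : Set.range (fun i => |g i|) = Set.Icc 1 (3 : ℤ) := hg
  funext i
  exact octahedronVertex_injOn (hf' ▸ Set.mem_range_self i) (hg' ▸ Set.mem_range_self i)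
    (congrFun (congrArg Prod.snd hfg) i)

/-! ### Full rank and interior centres -/

section

variable {m : ℕ}

/-- Apply a linear map to the centre and to all directions. -/
def pairMap (m : ℕ) {J K : Type*} (L : (J → ℝ) →ₗ[ℝ] (K → ℝ)) :
    (J → ℝ) × (Fin m → J → ℝ) →ₗ[ℝ] (K → ℝ) × (Fin m → K → ℝ) :=
  L.prodMap (L.compLeft (Fin m))

@[simp] theorem pairMap_fst {J K : Type*} (L : (J → ℝ) →ₗ[ℝ] (K → ℝ))
    (x : (J → ℝ) × (Fin m → J → ℝ)) : (pairMap m L x).1 = L x.1 := rfl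

@[simp] theorem pairMap_snd {J K : Type*} (L : (J → ℝ) →ₗ[ℝ] (K → ℝ))
    (x : (J → ℝ) × (Fin m → J → ℝ)) (i : Fin m) : (pairMap m L x).2 i = L (x.2 i) := rfl

/-- Barycentric coordinates to affine coordinates: forget the coordinate `0`. -/
abbrev dropZero (k : ℕ) : (Fin (k + 1) → ℝ) →ₗ[ℝ] (Fin k → ℝ) := LinearMap.funLeft ℝ ℝ Fin.succ

theorem image_simplexPairs_dropZero (m k : ℕ) :
    pairMap m (dropZero k) '' simplexPairs m (Fin (k + 1)) =
      {x | ∀ i, x.1 + x.2 i ∈ cornerSimplex k ∧ x.1 - x.2 i ∈ cornerSimplex k} := by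
  rw [cornerSimplex_eq]
  ext y
  constructor
  · rintro ⟨x, ⟨hb, ha, hab⟩, rfl⟩ i
    rw [Fin.sum_univ_succ] at hb
    have hai := ha i
    rw [Fin.sum_univ_succ] at hai
    have h := fun j => abs_le.1 (hab i j)
    have h0 := h 0
    refine ⟨⟨fun j => ?_, ?_⟩, fun j => ?_, ?_⟩
    · have := h j.succ
      simp [LinearMap.funLeft_apply]; linarith
    · simp [LinearMap.funLeft_apply, Finset.sum_add_distrib]; linarith
    · have := h j.succ
      simp [LinearMap.funLeft_apply]; linarith
    · simp [LinearMap.funLeft_apply]; linarith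
  · intro hy
    refine ⟨(Fin.cons (1 - ∑ j, y.1 j) y.1, fun i => Fin.cons (-∑ j, y.2 i j) (y.2 i)),
      ⟨?_, fun i => ?_, fun i j => ?_⟩, ?_⟩
    · simp [Fin.sum_univ_succ]
    · simp [Fin.sum_univ_succ]
    · obtain ⟨⟨h1, h2⟩, h3, h4⟩ := hy i
      simp only [Pi.add_apply, Pi.sub_apply, Finset.sum_add_distrib, Finset.sum_sub_distrib] at *
      refine Fin.cases ?_ (fun j => ?_) j
      · simp only [Fin.cons_zero]
        rw [abs_le]; constructor <;> linarith
      · simp only [Fin.cons_succ]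
        rw [abs_le]; constructor <;> linarith [h1 j, h3 j]
    · exact Prod.ext (funext fun j => by simp [LinearMap.funLeft_apply])
        (funext fun i => funext fun j => by simp [LinearMap.funLeft_apply])

/-- `dropZero` is not injective, but the prescribed coordinate sums recover coordinate `0`. -/
theorem injOn_pairMap_dropZero (m k : ℕ) :
    Set.InjOn (pairMap m (dropZero k)) (simplexPairs m (Fin (k + 1))) := by
  rintro x ⟨hb, ha, -⟩ y ⟨hb', ha', -⟩ hxy
  have h1 : ∀ j : Fin k, x.1 j.succ = y.1 j.succ := fun j =>
    congrFun (congrArg Prod.fst hxy) j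
  have h2 : ∀ i, ∀ j : Fin k, x.2 i j.succ = y.2 i j.succ := fun i j =>
    congrFun (congrFun (congrArg Prod.snd hxy) i) j
  simp only [Fin.sum_univ_succ] at hb hb' ha ha'
  refine Prod.ext (funext fun j => Fin.cases ?_ h1 j)
    (funext fun i => funext fun j => Fin.cases ?_ (h2 i) j)
  · have : ∑ j : Fin k, x.1 j.succ = ∑ j : Fin k, y.1 j.succ := Finset.sum_congr rfl fun j _ => h1 j
    linarith
  · have : ∑ j : Fin k, x.2 i j.succ = ∑ j : Fin k, y.2 i j.succ :=
      Finset.sum_congr rfl fun j _ => h2 i j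
    linarith [ha i, ha' i]

/-- The directions at an interior vertex affinely span the simplex. -/
theorem eq_of_sum_mul_eq_zero {J : Type*} [Fintype J] {x : (J → ℝ) × (Fin m → J → ℝ)}
    (hx : x ∈ interiorVertices m J) {φ : J → ℝ} (h : ∀ i, ∑ j, φ j * x.2 i j = 0) (j j' : J) :
    φ j = φ j' := by
  obtain ⟨hx, hpos⟩ := hx
  rw [mem_extremePoints_simplexPairs_iff] at hx
  obtain ⟨⟨hb, ha, -⟩, hx⟩ := hx
  set c := ∑ j, φ j * x.1 j
  -- Scaling coordinate `j` by `φ j - c` respects all tight equalities; the choice of `c` makes the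
  -- centre's deformation sum to zero.
  have h0 := hx (fun j => (φ j - c) * x.1 j, fun i j => (φ j - c) * x.2 i j)
    (by simp only [sub_mul, Finset.sum_sub_distrib, ← Finset.mul_sum, hb]; simp [c])
    (fun i => by simp only [sub_mul, Finset.sum_sub_distrib, ← Finset.mul_sum, ha, h]; simp)
    (fun i j hij => by simp [hij]) (fun i j hij => by simp [hij])
  have key : ∀ j, φ j = c := fun j => by
    have := congrFun (congrArg Prod.fst h0) j
    simpa [(hpos j).ne', sub_eq_zero] using this
  rw [key j, key j']

theorem affineRank_eq_iff {k : ℕ} (f : (Fin m → ℝ) →ᵃ[ℝ] (Fin k → ℝ)) :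
    affineRank f = k ↔ ∀ ψ : (Fin k → ℝ) →ₗ[ℝ] ℝ, (∀ i, ψ ((affineMapEquiv m k f).2 i) = 0) →
      ψ = 0 := by
  have hker : ∀ ψ : (Fin k → ℝ) →ₗ[ℝ] ℝ, (∀ i, ψ ((affineMapEquiv m k f).2 i) = 0) ↔
      LinearMap.range f.linear ≤ LinearMap.ker ψ := by
    intro ψ
    rw [LinearMap.range_le_ker_iff]
    constructor
    · intro h
      refine (Pi.basisFun ℝ (Fin m)).ext fun i => ?_
      simpa using h i
    · intro h i
      rw [affineMapEquiv_snd, ← LinearMap.comp_apply, h, LinearMap.zero_apply]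
  have htop : affineRank f = k ↔ LinearMap.range f.linear = ⊤ := by
    constructor
    · intro h
      exact Submodule.eq_top_of_finrank_eq (by rw [Module.finrank_fin_fun]; exact h)
    · intro h
      rw [affineRank, h, finrank_top, Module.finrank_fin_fun]
  rw [htop]
  constructor
  · intro h ψ hψ
    rw [hker, h, top_le_iff, LinearMap.ker_eq_top] at hψ
    exact hψ
  · intro h
    by_contra hne
    obtain ⟨ψ, hψ, hle⟩ := Submodule.exists_le_ker_of_lt_top _ (lt_top_iff_ne_top.2 hne)
    exact hψ (h ψ ((hker ψ).2 hle))

/-- A zero centre coordinate kills that coordinate of every direction and drops the rank;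
conversely, by `eq_of_sum_mul_eq_zero`, an interior centre leaves no functional vanishing on the
directions. -/
theorem image_vertexMapsOfRank (hm : 0 < m) (k : ℕ) :
    affineMapEquiv m k '' vertexMapsOfRank k (crosspolytope m) (cornerSimplex k) =
      pairMap m (dropZero k) '' interiorVertices m (Fin (k + 1)) := by
  have hvert := image_vertexMaps (m := m) (Q := cornerSimplex k) (convex_convexHull _ _)
  rw [← image_simplexPairs_dropZero] at hvert
  have hrank : ∀ (f : (Fin m → ℝ) →ᵃ[ℝ] (Fin k → ℝ)) (x : _),
      x ∈ Set.extremePoints ℝ (simplexPairs m (Fin (k + 1))) →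
      pairMap m (dropZero k) x = affineMapEquiv m k f →
      (affineRank f = k ↔ ∀ j, 0 < x.1 j) := by
    intro f x hx hxf
    have hψ' : ∀ (ψ : (Fin k → ℝ) →ₗ[ℝ] ℝ) (i : Fin m), ψ ((affineMapEquiv m k f).2 i) =
        ∑ j : Fin k, ψ (Pi.single j 1) * x.2 i j.succ := by
      intro ψ i
      rw [← hxf, pairMap_snd, LinearMap.pi_apply_eq_sum_univ ψ]
      refine Finset.sum_congr rfl fun j _ => ?_
      rw [smul_eq_mul, mul_comm, LinearMap.funLeft_apply]
      congr 2
      ext l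
      simp [Pi.single_apply, eq_comm]
    rw [affineRank_eq_iff]
    simp only [hψ']
    obtain ⟨hb, ha, hab⟩ : x ∈ simplexPairs m (Fin (k + 1)) := hx.1
    constructor
    · intro h j
      have h0 : 0 ≤ x.1 j := (abs_nonneg _).trans (hab ⟨0, hm⟩ j)
      refine h0.lt_of_ne fun hj => ?_
      have hz : ∀ i, x.2 i j = 0 := fun i => abs_nonpos_iff.1 ((hab i j).trans_eq hj.symm)
      revert hj hz h0
      -- Coordinate `0` is invisible after `dropZero`, so its functional is the sum of the remaining
      -- coordinates.
      refine Fin.cases (fun _ hj hz => ?_) (fun j _ hj hz => ?_) j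
      · rw [Fin.sum_univ_succ, ← hj, zero_add] at hb
        have hne : ∃ j : Fin k, x.1 j.succ ≠ 0 := by
          by_contra hcon
          push Not at hcon
          simp [hcon] at hb
        obtain ⟨l, -⟩ := hne
        have := h (∑ j : Fin k, LinearMap.proj j) fun i => by
          have hi := ha i
          rw [Fin.sum_univ_succ, hz, zero_add] at hi
          simpa [LinearMap.sum_apply] using hi
        have := congrArg (fun ψ : (Fin k → ℝ) →ₗ[ℝ] ℝ => ψ (Pi.single l 1)) this
        simp [LinearMap.sum_apply] at this
      · have := h (LinearMap.proj j) fun i => by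
          rw [Finset.sum_eq_single j] <;> simp +contextual [hz, eq_comm]
        have := congrArg (fun ψ : (Fin k → ℝ) →ₗ[ℝ] ℝ => ψ (Pi.single j 1)) this
        simp at this
    · intro hpos ψ hψ
      have key := eq_of_sum_mul_eq_zero (x := x) ⟨hx, hpos⟩
        (φ := Fin.cons 0 fun j => ψ (Pi.single j 1)) (fun i => by
          rw [Fin.sum_univ_succ]
          simpa using hψ i)
      refine (Pi.basisFun ℝ (Fin k)).ext fun j => ?_
      have := key j.succ 0
      simpa using this
  ext y
  constructor
  · rintro ⟨f, ⟨hf, hr⟩, rfl⟩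
    have hy : affineMapEquiv m k f ∈ _ := hvert.subset ⟨f, hf, rfl⟩
    obtain ⟨x, hx, hxf⟩ := hy.1
    rw [← hxf, LinearMap.map_mem_extremePoints_image_iff _ convex_simplexPairs
      (injOn_pairMap_dropZero m k) hx] at hy
    exact ⟨x, ⟨hy, (hrank f x hy hxf).1 hr⟩, hxf⟩
  · rintro ⟨x, ⟨hx, hpos⟩, rfl⟩
    have hy := (LinearMap.map_mem_extremePoints_image_iff _ convex_simplexPairs
      (injOn_pairMap_dropZero m k) hx.1).2 hx
    obtain ⟨f, hf, hfx⟩ := hvert.superset hy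
    exact ⟨f, ⟨hf, (hrank f x hx hfx.symm).2 hpos⟩, hfx⟩

theorem finite_vertexMapsOfRank (hm : 0 < m) (k : ℕ) :
    (vertexMapsOfRank k (crosspolytope m) (cornerSimplex k)).Finite := by
  refine Set.Finite.of_finite_image ?_ (affineMapEquiv m k).injective.injOn
  rw [image_vertexMapsOfRank hm]
  exact finite_interiorVertices.image _

theorem ncard_vertexMapsOfRank (hm : 0 < m) (k : ℕ) :
    (vertexMapsOfRank k (crosspolytope m) (cornerSimplex k)).ncard =
      (interiorVertices m (Fin (k + 1))).ncard := by
  rw [← Set.ncard_image_of_injective _ (affineMapEquiv m k).injective, image_vertexMapsOfRank hm]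
  exact ((injOn_pairMap_dropZero m k).mono fun x hx => hx.1.1).ncard_image

theorem ncard_interiorVertices_eq_zero (hm : 0 < m) {k : ℕ} (hk : m < k) :
    (interiorVertices m (Fin (k + 1))).ncard = 0 := by
  rw [← ncard_vertexMapsOfRank hm, Set.ncard_eq_zero (finite_vertexMapsOfRank hm k)]
  refine Set.eq_empty_of_forall_notMem fun f hf => ?_
  have h := LinearMap.finrank_range_le f.linear
  have : Module.finrank ℝ (LinearMap.range f.linear) = k := hf.2
  rw [this, Module.finrank_fin_fun] at h
  omega

end

/-! ### Centres of the vertices of `ballPairs` -/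

section

variable {m : ℕ} {J : Type*} [Fintype J] {x : (J → ℝ) × (Fin m → J → ℝ)}

theorem sign_mul_eq_abs_of_sum_eq_one {u : J → ℝ} {s : J → SignType} (hu : ∑ j, |u j| ≤ 1)
    (hs : ∑ j, (s j : ℝ) * u j = 1) (j : J) : (s j : ℝ) * u j = |u j| := by
  have hle : ∀ j ∈ Finset.univ, (s j : ℝ) * u j ≤ |u j| := fun j _ => sign_mul_le_abs _ _
  exact (Finset.sum_eq_sum_iff_of_le hle).1 (le_antisymm (Finset.sum_le_sum hle) (hs ▸ hu)) j
    (Finset.mem_univ j)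

theorem eq_sign_of_mul_eq_abs {s : SignType} {t : ℝ} (h : (s : ℝ) * t = |t|) (ht : t ≠ 0) :
    s = SignType.sign t := by
  rcases ht.lt_or_gt with ht | ht
  · rw [sign_neg ht]
    rw [abs_of_neg ht] at h
    cases s
    · simp at h; linarith
    · rfl
    · simp at h; linarith
  · rw [sign_pos ht]
    rw [abs_of_pos ht] at h
    cases s
    · simp at h; linarith
    · simp at h; linarith
    · rfl

theorem sum_abs_centre_le (hm : 0 < m) (hx : x ∈ ballPairs m J) : ∑ j, |x.1 j| ≤ 1 := by
  obtain ⟨h1, h2⟩ := hx ⟨0, hm⟩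
  have : ∀ j, 2 * |x.1 j| ≤ |x.1 j + x.2 ⟨0, hm⟩ j| + |x.1 j - x.2 ⟨0, hm⟩ j| := fun j => by
    rw [← abs_two, ← abs_mul]
    refine le_trans (le_of_eq ?_) (abs_add_le _ _)
    congr 1; ring
  have := Finset.sum_le_sum fun j (_ : j ∈ Finset.univ) => this j
  rw [← Finset.mul_sum, Finset.sum_add_distrib] at this
  linarith

/-- The centre of a vertex is either the origin or a boundary point of the `ℓ¹` ball. -/
theorem sum_abs_centre_eq_one (hm : 0 < m) (hx : x ∈ Set.extremePoints ℝ (ballPairs m J))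
    (hb : x.1 ≠ 0) : ∑ j, |x.1 j| = 1 := by
  classical
  refine le_antisymm (sum_abs_centre_le hm hx.1) (le_of_not_gt fun hlt => hb ?_)
  rw [mem_extremePoints_ballPairs_iff] at hx
  -- If `‖b‖₁ < 1`, the centre can be moved radially: each direction admits a `d` making `(b, d)`
  -- respect its active constraints. If only one of `b ± aᵢ` has norm `1`, take `d = ∓ b`.
  have key : ∀ i, ∃ d : J → ℝ,
      (∀ s : J → SignType, ∑ j, (s j : ℝ) * (x.1 j + x.2 i j) = 1 →
        ∑ j, (s j : ℝ) * (x.1 j + d j) = 0) ∧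
      ∀ s : J → SignType, ∑ j, (s j : ℝ) * (x.1 j - x.2 i j) = 1 →
        ∑ j, (s j : ℝ) * (x.1 j - d j) = 0 := by
    intro i
    obtain ⟨hu, hw⟩ := hx.1 i
    have inactive : ∀ (u : J → ℝ), ∑ j, |u j| < 1 → ∀ s : J → SignType,
        ∑ j, (s j : ℝ) * u j ≠ 1 := fun u hu s hs => by
      have := Finset.sum_le_sum fun j (_ : j ∈ Finset.univ) => sign_mul_le_abs (s j) (u j)
      linarith
    rcases hu.lt_or_eq with hu' | hu'
    · exact ⟨x.1, fun s hs => absurd hs (inactive _ hu' s), fun s _ => by simp⟩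
    rcases hw.lt_or_eq with hw' | hw'
    · exact ⟨-x.1, fun s _ => by simp, fun s hs => absurd hs (inactive _ hw' s)⟩
    -- Without a coordinate of opposite signs, the triangle inequality would be an equality and give
    -- `‖b‖₁ = 1`.
    obtain ⟨k, hk⟩ : ∃ k, (x.1 k + x.2 i k) * (x.1 k - x.2 i k) < 0 := by
      by_contra hcon
      push Not at hcon
      have : ∀ j, 2 * |x.1 j| = |x.1 j + x.2 i j| + |x.1 j - x.2 i j| := fun j => by
        rw [← abs_add_eq_add_abs_iff _ _ |>.2 (mul_nonneg_iff.1 (hcon j)), ← abs_two, ← abs_mul]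
        congr 1; ring
      have := Finset.sum_congr rfl fun j (_ : j ∈ Finset.univ) => this j
      rw [← Finset.mul_sum, Finset.sum_add_distrib] at this
      linarith
    have hku : x.1 k + x.2 i k ≠ 0 := left_ne_zero_of_mul hk.ne
    have hkw : x.1 k - x.2 i k ≠ 0 := right_ne_zero_of_mul hk.ne
    set σ := SignType.sign (x.1 k + x.2 i k) with hσ
    have hσw : SignType.sign (x.1 k - x.2 i k) = -σ := by
      rcases mul_neg_iff.1 hk with ⟨h1, h2⟩ | ⟨h1, h2⟩
      · rw [hσ, sign_pos h1, sign_neg h2]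
      · rw [hσ, sign_pos h2, sign_neg h1]; rfl
    have hσσ : (σ : ℝ) * σ = 1 := by
      rcases hku.lt_or_gt with h | h
      · rw [hσ, sign_neg h]; simp
      · rw [hσ, sign_pos h]; simp
    -- Active forms at `b + aᵢ` have sign `σ` at `k`, those at `b - aᵢ` sign `-σ`; subtracting `σ
    -- eₖ` from `aᵢ` lowers both values from `1` to `0`.
    refine ⟨fun j => x.2 i j - Pi.single (M := fun _ => ℝ) k (σ : ℝ) j, fun s hs => ?_,
      fun s hs => ?_⟩
    · have := eq_sign_of_mul_eq_abs (sign_mul_eq_abs_of_sum_eq_one hu hs k) hku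
      have e : ∀ j, (s j : ℝ) * (x.1 j + (x.2 i j - Pi.single (M := fun _ => ℝ) k (σ : ℝ) j)) =
          (s j : ℝ) * (x.1 j + x.2 i j) - s j * Pi.single (M := fun _ => ℝ) k (σ : ℝ) j :=
        fun j => by ring
      simp_rw [e]
      rw [Finset.sum_sub_distrib, hs]
      simp [Pi.single_apply, this, ← hσ, hσσ]
    · have := eq_sign_of_mul_eq_abs (sign_mul_eq_abs_of_sum_eq_one hw hs k) hkw
      have e : ∀ j, (s j : ℝ) * (x.1 j - (x.2 i j - Pi.single (M := fun _ => ℝ) k (σ : ℝ) j)) =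
          (s j : ℝ) * (x.1 j - x.2 i j) + s j * Pi.single (M := fun _ => ℝ) k (σ : ℝ) j :=
        fun j => by ring
      simp_rw [e]
      rw [Finset.sum_add_distrib, hs]
      simp [Pi.single_apply, this, hσw, hσσ]
  choose d hd1 hd2 using key
  exact congrArg Prod.fst (hx.2 (x.1, d) hd1 hd2)

/-- Vertices centred at the origin send each basis vector to a vertex of the crosspolytope. -/
theorem centred_vertices_eq [DecidableEq J] [Nonempty J] (hm : 0 < m) :
    {x | x ∈ Set.extremePoints ℝ (ballPairs m J) ∧ x.1 = 0} =
      Set.range fun t : Fin m → J × Bool =>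
        ((0, fun i => Pi.single (t i).1 (if (t i).2 then 1 else -1)) :
          (J → ℝ) × (Fin m → J → ℝ)) := by
  ext x
  constructor
  · rintro ⟨hx, hb⟩
    rw [mem_extremePoints_ballPairs_iff] at hx
    have key : ∀ i (d : J → ℝ), (∀ s : J → SignType, ∑ j, (s j : ℝ) * x.2 i j = 1 →
        ∑ j, (s j : ℝ) * d j = 0) → d = 0 := by
      intro i d hd
      have h0 := hx.2 (0, Pi.single i d) (fun k s hs => by
          by_cases hk : k = i
          · subst hk
            simp only [hb, Pi.zero_apply, zero_add, Pi.single_eq_same] at hs ⊢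
            exact hd s hs
          · simp [hk]) (fun k s hs => by
          by_cases hk : k = i
          · subst hk
            simp only [hb, Pi.zero_apply, zero_sub, Pi.single_eq_same, mul_neg,
              Finset.sum_neg_distrib] at hs ⊢
            have := hd (fun j => -s j) (by simpa using hs)
            simpa using this
          · simp [hk])
      simpa using congrFun (congrArg Prod.snd h0) i
    have hnorm : ∀ i, ∑ j, |x.2 i j| ≤ 1 := fun i => by simpa [hb] using (hx.1 i).1
    have hex : ∀ i, ∃ p : J × Bool, Pi.single p.1 (if p.2 then 1 else -1) = x.2 i := by
      intro i
      have h1 : ∑ j, |x.2 i j| = 1 := by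
        refine le_antisymm (hnorm i) (le_of_not_gt fun hlt => ?_)
        have := key i 1 fun s hs => by
          have := Finset.sum_le_sum fun j (_ : j ∈ Finset.univ) => sign_mul_le_abs (s j) (x.2 i j)
          linarith
        exact one_ne_zero this
      obtain ⟨k, hk⟩ : ∃ k, x.2 i k ≠ 0 := by
        by_contra hcon
        push Not at hcon
        simp [hcon] at h1
      have hz : ∀ j, j ≠ k → x.2 i j = 0 := by
        intro j hjk
        by_contra hj
        -- Mass shifts between two nonzero coordinates without changing the `ℓ¹` norm.
        have h0 := key i (Pi.single k (SignType.sign (x.2 i k) : ℝ) -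
          Pi.single j (SignType.sign (x.2 i j) : ℝ)) fun s hs => by
            have e := sign_mul_eq_abs_of_sum_eq_one (hnorm i) hs
            have e1 := eq_sign_of_mul_eq_abs (e k) hk
            have e2 := eq_sign_of_mul_eq_abs (e j) hj
            have sq : ∀ {t : ℝ}, t ≠ 0 →
                ((SignType.sign t : SignType) : ℝ) * (SignType.sign t : SignType) = 1 := by
              intro t ht
              rcases ht.lt_or_gt with h | h
              · simp [sign_neg h]
              · simp [sign_pos h]
            simp only [Pi.sub_apply, mul_sub, Finset.sum_sub_distrib]
            simp [Pi.single_apply, e1, e2, sq hk, sq hj]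
        have := congrFun h0 k
        rcases hk.lt_or_gt with h | h
        · simp [hjk.symm, sign_neg h] at this
        · simp [hjk.symm, sign_pos h] at this
      have hk1 : |x.2 i k| = 1 := by
        rw [← h1, Finset.sum_eq_single k] <;> simp +contextual [hz]
      rcases (abs_eq zero_le_one).1 hk1 with h | h
      · refine ⟨(k, true), funext fun j => ?_⟩
        by_cases hj : j = k
        · subst hj; simp [h]
        · simp [hj, hz j hj]
      · refine ⟨(k, false), funext fun j => ?_⟩
        by_cases hj : j = k
        · subst hj; simp [h]
        · simp [hj, hz j hj]
    choose t ht using hex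
    exact ⟨t, Prod.ext hb.symm (funext ht)⟩
  · rintro ⟨t, rfl⟩
    have habs : ∀ p : J × Bool, ∑ j, |(Pi.single p.1 (if p.2 then 1 else -1) : J → ℝ) j| = 1 := by
      intro p
      rw [Finset.sum_eq_single p.1]
      · by_cases h : p.2 <;> simp [h]
      · intro j _ hj; simp [hj]
      · simp
    have hzero : ∀ (p : J × Bool) (d : J → ℝ), (∀ s : J → SignType,
        ∑ j, (s j : ℝ) * (Pi.single p.1 (if p.2 then 1 else -1) : J → ℝ) j = 1 →
          ∑ j, (s j : ℝ) * d j = 0) → d = 0 := by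
      rintro ⟨k, q⟩ d hd
      have hd' : ∀ s : J → SignType, (s k : ℝ) = (if q then 1 else -1) →
          ∑ j, (s j : ℝ) * d j = 0 := fun s hs => hd s (by
        rw [Finset.sum_eq_single k]
        · by_cases h : q <;> simp [hs, h]
        · intro j _ hj; simp [hj]
        · simp)
      set σ : SignType := if q then 1 else -1 with hσ
      have hσ' : (σ : ℝ) = if q then 1 else -1 := by by_cases h : q <;> simp [hσ, h]
      have hσ0 : (σ : ℝ) ≠ 0 := by by_cases h : q <;> simp [hσ', h]
      have hk : d k = 0 := by
        -- The form supported at `k` alone gives `d k = 0`; adding one more nonzero entry at `j`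
        -- gives `d j = 0`.
        have := hd' (Pi.single k σ) (by simp [hσ'])
        rw [Finset.sum_eq_single k] at this
        · simpa [hσ0] using this
        · intro j _ hj; simp [hj]
        · simp
      funext j
      by_cases hj : j = k
      · rw [hj, hk]; rfl
      · have := hd' (fun l => if l = k then σ else if l = j then 1 else 0) (by simp [hσ'])
        rw [Finset.sum_eq_single j] at this
        · simpa [hj] using this
        · intro l _ hl
          by_cases hlk : l = k
          · simp [hlk, hk]
          · simp [hl, hlk]
        · simp
    refine ⟨(mem_extremePoints_ballPairs_iff _).2 ⟨fun i => ?_, fun v h1 h2 => ?_⟩, rfl⟩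
    · simpa using (habs (t i)).le
    · have hp : ∀ i, v.1 + v.2 i = 0 := fun i => hzero (t i) _ fun s hs => by
        simpa using h1 i s (by simpa using hs)
      have hq : ∀ i, v.1 - v.2 i = 0 := fun i => hzero (t i) _ fun s hs => by
        have := h2 i (fun j => -s j) (by simpa using hs)
        simpa using this
      have hb : v.1 = 0 := by
        have := hp ⟨0, hm⟩
        have h' := hq ⟨0, hm⟩
        have h2 : (2 : ℝ) • v.1 = 0 := by
          rw [two_smul]
          calc v.1 + v.1 = (v.1 + v.2 ⟨0, hm⟩) + (v.1 - v.2 ⟨0, hm⟩) := by abel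
            _ = 0 := by rw [this, h', add_zero]
        exact (smul_eq_zero.1 h2).resolve_left two_ne_zero
      exact Prod.ext hb (funext fun i => by simpa [hb] using hp i)

theorem ncard_centred_vertices [DecidableEq J] [Nonempty J] (hm : 0 < m) :
    {x | x ∈ Set.extremePoints ℝ (ballPairs m J) ∧ x.1 = 0}.ncard =
      (2 * Fintype.card J) ^ m := by
  rw [centred_vertices_eq hm, ← Set.image_univ, Set.ncard_image_of_injective, Set.ncard_univ]
  · simp [mul_comm]
  · intro s t hst
    funext i
    have h : (Pi.single (s i).1 (if (s i).2 then 1 else -1) : J → ℝ) =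
        Pi.single (t i).1 (if (t i).2 then 1 else -1) := congrFun (congrArg Prod.snd hst) i
    generalize s i = a at h ⊢
    generalize t i = b at h ⊢
    obtain ⟨j, p⟩ := a
    obtain ⟨k, q⟩ := b
    have hjk : j = k := by
      by_contra hne
      have := congrFun h j
      by_cases hp : p <;> simp [hne, hp] at this
    subst hjk
    have := congrFun h j
    cases p <;> cases q <;> simp at this ⊢ <;> norm_num at this

end

/-! ### Faces indexed by sign vectors, and the count -/

section

variable {m n k : ℕ}

/-- The face of `ballPairs` on which the form `∑ εⱼ bⱼ` takes the value `1`. -/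
def signFace (m : ℕ) (ε : Fin n → SignType) : Set ((Fin n → ℝ) × (Fin m → Fin n → ℝ)) :=
  {x | x ∈ ballPairs m (Fin n) ∧ ∑ j, (ε j : ℝ) * x.1 j = 1}

theorem sum_sign_mul_centre_le (hm : 0 < m) (ε : Fin n → SignType)
    {x : (Fin n → ℝ) × (Fin m → Fin n → ℝ)} (hx : x ∈ ballPairs m (Fin n)) :
    ∑ j, (ε j : ℝ) * x.1 j ≤ 1 :=
  (Finset.sum_le_sum fun _ _ => sign_mul_le_abs _ _).trans (sum_abs_centre_le hm hx)

/-- The form is at most `1` on all of `ballPairs`, so a point inside a segment attains `1` only if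
both ends do. Vertices of the face are therefore vertices of `ballPairs`. -/
theorem isExtreme_signFace (hm : 0 < m) (ε : Fin n → SignType) :
    IsExtreme ℝ (ballPairs m (Fin n)) (signFace m ε) := by
  refine ⟨fun x hx => hx.1, ?_⟩
  rintro x hx y hy _ ⟨-, hz⟩ ⟨a, b, ha, hb, hab, rfl⟩
  refine ⟨hx, le_antisymm (sum_sign_mul_centre_le hm ε hx) ?_⟩
  have h1 := sum_sign_mul_centre_le hm ε hy
  have e : ∑ j, (ε j : ℝ) * (a • x + b • y).1 j =
      a * ∑ j, (ε j : ℝ) * x.1 j + b * ∑ j, (ε j : ℝ) * y.1 j := by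
    rw [Finset.mul_sum, Finset.mul_sum, ← Finset.sum_add_distrib]
    refine Finset.sum_congr rfl fun j _ => ?_
    simp only [Prod.fst_add, Prod.smul_fst, Pi.add_apply, Pi.smul_apply, smul_eq_mul]
    ring
  rw [e] at hz
  by_contra hlt
  push Not at hlt
  have := mul_lt_mul_of_pos_left hlt ha
  have := mul_le_mul_of_nonneg_left h1 hb.le
  linarith

theorem convex_signFace (m : ℕ) (ε : Fin n → SignType) : Convex ℝ (signFace m ε) := by
  rintro x ⟨hx, hx'⟩ y ⟨hy, hy'⟩ a b ha hb hab
  refine ⟨convex_ballPairs hx hy ha hb hab, ?_⟩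
  calc ∑ j, (ε j : ℝ) * (a • x + b • y).1 j =
      a * ∑ j, (ε j : ℝ) * x.1 j + b * ∑ j, (ε j : ℝ) * y.1 j := by
        rw [Finset.mul_sum, Finset.mul_sum, ← Finset.sum_add_distrib]
        refine Finset.sum_congr rfl fun j _ => ?_
        simp only [Prod.fst_add, Prod.smul_fst, Pi.add_apply, Pi.smul_apply, smul_eq_mul]
        ring
    _ = 1 := by rw [hx', hy', mul_one, mul_one, hab]

/-- The values of the form at `b ± aᵢ` average to `1` and are at most `1`, so both equal `1`;
equality with the `ℓ¹` norm then fixes the signs coordinatewise. -/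
theorem signFace_coord (hm : 0 < m) {ε : Fin n → SignType}
    {x : (Fin n → ℝ) × (Fin m → Fin n → ℝ)} (hx : x ∈ signFace m ε) :
    (∀ j, (ε j : ℝ) * x.1 j = |x.1 j|) ∧
      (∀ i j, (ε j : ℝ) * (x.1 j + x.2 i j) = |x.1 j + x.2 i j|) ∧
      (∀ i j, (ε j : ℝ) * (x.1 j - x.2 i j) = |x.1 j - x.2 i j|) ∧
      ∀ i, ∑ j, (ε j : ℝ) * x.2 i j = 0 := by
  have key : ∀ i, ∑ j, (ε j : ℝ) * x.2 i j = 0 := by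
    intro i
    have h1 := (sum_abs_le_one_iff _).1 (hx.1 i).1 ε
    have h2 := (sum_abs_le_one_iff _).1 (hx.1 i).2 ε
    simp only [mul_add, mul_sub, Finset.sum_add_distrib, Finset.sum_sub_distrib, hx.2] at h1 h2
    linarith
  refine ⟨sign_mul_eq_abs_of_sum_eq_one (sum_abs_centre_le hm hx.1) hx.2, fun i => ?_, fun i => ?_,
    key⟩
  · refine sign_mul_eq_abs_of_sum_eq_one (u := fun j => x.1 j + x.2 i j) (hx.1 i).1 ?_
    simp only [mul_add, Finset.sum_add_distrib, hx.2, key, add_zero]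
  · refine sign_mul_eq_abs_of_sum_eq_one (u := fun j => x.1 j - x.2 i j) (hx.1 i).2 ?_
    simp only [mul_sub, Finset.sum_sub_distrib, hx.2, key, sub_zero]

theorem signType_mul_self {s : SignType} (hs : s ≠ 0) : (s : ℝ) * s = 1 := by
  cases s
  · exact absurd rfl hs
  · simp
  · simp

/-- Barycentric coordinates on the face of the crosspolytope with sign vector `ε`, whose support is
enumerated by `e`. -/
def signCoords (ε : Fin n → SignType) (e : Fin (k + 1) → Fin n) :
    (Fin n → ℝ) →ₗ[ℝ] (Fin (k + 1) → ℝ) where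
  toFun c i := ε (e i) * c (e i)
  map_add' c d := by ext i; simp [mul_add]
  map_smul' r c := by ext i; simp [mul_left_comm]

@[simp] theorem signCoords_apply (ε : Fin n → SignType) (e : Fin (k + 1) → Fin n) (c : Fin n → ℝ)
    (i : Fin (k + 1)) : signCoords ε e c i = ε (e i) * c (e i) := rfl

variable {ε : Fin n → SignType} {e : Fin (k + 1) → Fin n}

theorem sum_signCoords (he : Function.Injective e) (hr : Set.range e = {j | ε j ≠ 0})
    (c : Fin n → ℝ) : ∑ i, signCoords ε e c i = ∑ j, (ε j : ℝ) * c j :=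
  Fintype.sum_of_injective e he _ _ (fun j hj => by
    rw [hr] at hj
    have : ε j = 0 := not_not.1 hj
    simp [this]) fun i => rfl

theorem injOn_pairMap_signCoords (hm : 0 < m) (hr : Set.range e = {j | ε j ≠ 0}) :
    Set.InjOn (pairMap m (signCoords ε e)) (signFace m ε) := by
  intro x hx y hy hxy
  obtain ⟨hx1, hx2, -, -⟩ := signFace_coord hm hx
  obtain ⟨hy1, hy2, -, -⟩ := signFace_coord hm hy
  have h1 : ∀ i, (ε (e i) : ℝ) * x.1 (e i) = ε (e i) * y.1 (e i) := fun i =>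
    congrFun (congrArg Prod.fst hxy) i
  have h2 : ∀ l i, (ε (e i) : ℝ) * x.2 l (e i) = ε (e i) * y.2 l (e i) := fun l i =>
    congrFun (congrFun (congrArg Prod.snd hxy) l) i
  have hz : ∀ {s : SignType} {t : ℝ}, s = 0 → (s : ℝ) * t = |t| → t = 0 := by
    rintro s t rfl h
    simpa [eq_comm] using h
  have hcancel : ∀ {s : SignType} {t u : ℝ}, s ≠ 0 → (s : ℝ) * t = s * u → t = u := by
    intro s t u hs h
    refine mul_left_cancel₀ (fun h0 => ?_) h
    have := signType_mul_self hs
    rw [h0] at this; simp at this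
  have hb : ∀ j, x.1 j = y.1 j := by
    intro j
    by_cases hj : ε j = 0
    · rw [hz hj (hx1 j), hz hj (hy1 j)]
    · obtain ⟨i, rfl⟩ : j ∈ Set.range e := by rw [hr]; exact hj
      exact hcancel hj (h1 i)
  refine Prod.ext (funext hb) (funext fun l => funext fun j => ?_)
  by_cases hj : ε j = 0
  · have e1 := hz hj (hx2 l j)
    have e2 := hz hj (hy2 l j)
    have := hb j
    linarith
  · obtain ⟨i, rfl⟩ : j ∈ Set.range e := by rw [hr]; exact hj
    exact hcancel hj (h2 l i)

theorem image_signFace (hm : 0 < m) (he : Function.Injective e)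
    (hr : Set.range e = {j | ε j ≠ 0}) :
    pairMap m (signCoords ε e) '' signFace m ε = simplexPairs m (Fin (k + 1)) := by
  have hne : ∀ i, ε (e i) ≠ 0 := fun i => by
    have : e i ∈ {j | ε j ≠ 0} := hr ▸ Set.mem_range_self i
    exact this
  ext y
  constructor
  · rintro ⟨x, hx, rfl⟩
    obtain ⟨hx1, hx2, hx3, hx4⟩ := signFace_coord hm hx
    refine ⟨?_, fun l => ?_, fun l i => ?_⟩
    · rw [pairMap_fst, sum_signCoords he hr, hx.2]
    · rw [pairMap_snd, sum_signCoords he hr, hx4]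
    · rw [pairMap_fst, pairMap_snd, signCoords_apply, signCoords_apply, abs_le]
      have h2 := (hx2 l (e i)).ge.trans' (abs_nonneg _)
      have h3 := (hx3 l (e i)).ge.trans' (abs_nonneg _)
      rw [mul_add] at h2
      rw [mul_sub] at h3
      constructor <;> linarith
  · rintro ⟨hb, ha, hab⟩
    -- Values of `g` off the range of `e` are arbitrary; the factor `ε j = 0` removes them.
    let g := Function.invFun e
    have hg : ∀ i, g (e i) = i := Function.leftInverse_invFun he
    have habs : ∀ c : Fin (k + 1) → ℝ, ∑ j, |(ε j : ℝ) * c (g j)| = ∑ i, |c i| := fun c => by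
      refine (Fintype.sum_of_injective e he _ _ (fun j hj => ?_) fun i => ?_).symm
      · rw [hr] at hj
        have : ε j = 0 := not_not.1 hj
        simp [this]
      · have : |(ε (e i) : ℝ)| = 1 := by
          have h2 := signType_mul_self (hne i)
          rw [← abs_mul_abs_self] at h2
          exact (mul_self_eq_one_iff.1 h2).resolve_right fun h => by
            linarith [abs_nonneg (ε (e i) : ℝ)]
        rw [abs_mul, this, one_mul, hg]
    refine ⟨(fun j => ε j * y.1 (g j), fun l j => ε j * y.2 l (g j)), ⟨fun l => ⟨?_, ?_⟩, ?_⟩, ?_⟩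
    · have := habs fun i => y.1 i + y.2 l i
      simp only [mul_add] at this
      rw [this, Finset.sum_congr rfl fun i _ => abs_of_nonneg _, Finset.sum_add_distrib, hb, ha,
        add_zero]
      exact fun i _ => by linarith [abs_le.1 (hab l i)]
    · have := habs fun i => y.1 i - y.2 l i
      simp only [mul_sub] at this
      rw [this, Finset.sum_congr rfl fun i _ => abs_of_nonneg _, Finset.sum_sub_distrib, hb, ha,
        sub_zero]
      exact fun i _ => by linarith [abs_le.1 (hab l i)]
    · rw [← sum_signCoords he hr, ← hb]
      refine Finset.sum_congr rfl fun i _ => ?_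
      simp only [signCoords_apply]
      rw [← mul_assoc, signType_mul_self (hne i), one_mul, hg]
    · refine Prod.ext (funext fun i => ?_) (funext fun l => funext fun i => ?_)
      · simp only [pairMap_fst, signCoords_apply]
        rw [← mul_assoc, signType_mul_self (hne i), one_mul, hg]
      · simp only [pairMap_snd, signCoords_apply]
        rw [← mul_assoc, signType_mul_self (hne i), one_mul, hg]

/-- The vertices of `ballPairs` whose centre has sign vector `ε`. -/
def signFibre (m : ℕ) (ε : Fin n → SignType) : Set ((Fin n → ℝ) × (Fin m → Fin n → ℝ)) :=
  {x | x ∈ Set.extremePoints ℝ (ballPairs m (Fin n)) ∧ (fun j => SignType.sign (x.1 j)) = ε}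

theorem ncard_signFibre (hm : 0 < m) (he : Function.Injective e)
    (hr : Set.range e = {j | ε j ≠ 0}) :
    (signFibre m ε).ncard = (interiorVertices m (Fin (k + 1))).ncard := by
  have hne : ∀ i, ε (e i) ≠ 0 := fun i => by
    have : e i ∈ {j | ε j ≠ 0} := hr ▸ Set.mem_range_self i
    exact this
  have hsub : signFibre m ε ⊆ signFace m ε := by
    rintro x ⟨hx, hxε⟩
    refine ⟨hx.1, ?_⟩
    have hb : x.1 ≠ 0 := by
      intro h0
      apply hne 0
      rw [← hxε]
      simp [h0]
    rw [← sum_abs_centre_eq_one hm hx hb, ← hxε]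
    simp only [sign_mul_self]
  have hext : ∀ x ∈ signFace m ε, (pairMap m (signCoords ε e) x ∈
      Set.extremePoints ℝ (simplexPairs m (Fin (k + 1))) ↔
      x ∈ Set.extremePoints ℝ (ballPairs m (Fin n))) := by
    intro x hx
    rw [← image_signFace hm he hr, LinearMap.map_mem_extremePoints_image_iff _
      (convex_signFace m ε) (injOn_pairMap_signCoords hm hr) hx,
      (isExtreme_signFace hm ε).extremePoints_eq]
    exact and_iff_right hx
  have himage : pairMap m (signCoords ε e) '' signFibre m ε =
      interiorVertices m (Fin (k + 1)) := by
    ext y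
    constructor
    · rintro ⟨x, hx, rfl⟩
      refine ⟨(hext x (hsub hx)).2 hx.1, fun i => ?_⟩
      rw [pairMap_fst, signCoords_apply, (signFace_coord hm (hsub hx)).1, abs_pos]
      intro h0
      apply hne i
      rw [← hx.2]
      simp [h0]
    · rintro ⟨hy, hpos⟩
      obtain ⟨x, hx, rfl⟩ : y ∈ pairMap m (signCoords ε e) '' signFace m ε := by
        rw [image_signFace hm he hr]; exact hy.1
      refine ⟨x, ⟨(hext x hx).1 hy, funext fun j => ?_⟩, rfl⟩
      have hj := (signFace_coord hm hx).1 j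
      by_cases h0 : ε j = 0
      · rw [h0] at hj
        rw [h0, sign_eq_zero_iff]
        simpa using hj.symm
      · obtain ⟨i, rfl⟩ : j ∈ Set.range e := by rw [hr]; exact h0
        have := hpos i
        rw [pairMap_fst, signCoords_apply] at this
        exact (eq_sign_of_mul_eq_abs hj (right_ne_zero_of_mul this.ne')).symm
  rw [← himage, ((injOn_pairMap_signCoords hm hr).mono hsub).ncard_image]

/-- The number of sign vectors with a prescribed support. -/
theorem card_sign_vectors_of_support (S : Finset (Fin n)) :
    (Finset.univ.filter fun ε : Fin n → SignType =>
      Finset.univ.filter (fun j => ε j ≠ 0) = S).card = 2 ^ S.card := by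
  have : (Finset.univ.filter fun ε : Fin n → SignType =>
      Finset.univ.filter (fun j => ε j ≠ 0) = S) =
      Fintype.piFinset fun j => if j ∈ S then {1, -1} else {0} := by
    ext ε
    simp only [Finset.mem_filter, Finset.mem_univ, true_and, Fintype.mem_piFinset, Finset.ext_iff]
    refine forall_congr' fun j => ?_
    by_cases hj : j ∈ S
    · simp only [hj, if_true, Finset.mem_insert, Finset.mem_singleton]
      cases ε j <;> decide
    · simp [hj]
  rw [this, Fintype.card_piFinset]
  have h2 : ∀ j, (if j ∈ S then ({1, -1} : Finset SignType) else {0}).card =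
      if j ∈ S then 2 else 1 := fun j => by split_ifs <;> rfl
  simp only [h2]
  rw [Finset.prod_ite]
  simp

/-- Vertices are sorted by the sign vector of their centre. The fibre size depends only on the
support size `k + 1`; empty support is the centred case. -/
theorem ncard_extremePoints_ballPairs (hm : 0 < m) (hn : 0 < n) :
    (Set.extremePoints ℝ (ballPairs m (Fin n))).ncard = (2 * n) ^ m +
      ∑ k ∈ Finset.range n,
        2 ^ (k + 1) * n.choose (k + 1) * (interiorVertices m (Fin (k + 1))).ncard := by
  classical
  have : Nonempty (Fin n) := ⟨⟨0, hn⟩⟩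
  have hfin := finite_extremePoints_ballPairs m (Fin n)
  let h : ℕ → ℕ := fun c => Nat.casesOn c ((2 * n) ^ m)
    fun k => (interiorVertices m (Fin (k + 1))).ncard
  have hfib : ∀ ε : Fin n → SignType, (signFibre m ε).ncard =
      h (Finset.univ.filter (fun j => ε j ≠ 0)).card := by
    intro ε
    rcases hc : (Finset.univ.filter (fun j => ε j ≠ 0)).card with _ | k
    · have hε : ε = 0 := by
        rw [Finset.card_eq_zero, Finset.filter_eq_empty_iff] at hc
        exact funext fun j => not_not.1 (hc (Finset.mem_univ j))
      have hset : signFibre m ε =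
          {x | x ∈ Set.extremePoints ℝ (ballPairs m (Fin n)) ∧ x.1 = 0} := by
        ext x
        refine and_congr_right fun _ => ?_
        simp [hε, funext_iff]
      rw [hset, ncard_centred_vertices hm, Fintype.card_fin]
      rfl
    · refine ncard_signFibre hm (e := fun i => (Finset.univ.filter (fun j => ε j ≠ 0)).orderEmbOfFin
        hc i) (RelEmbedding.injective _) ?_
      rw [Finset.range_orderEmbOfFin]
      simp
  have hsum : (Set.extremePoints ℝ (ballPairs m (Fin n))).ncard =
      ∑ ε : Fin n → SignType, (signFibre m ε).ncard := by
    rw [Set.ncard_eq_toFinset_card _ hfin, Finset.card_eq_sum_card_fiberwise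
      (f := fun x j => SignType.sign (x.1 j)) (t := Finset.univ) (fun _ _ => by simp)]
    refine Finset.sum_congr rfl fun ε _ => ?_
    rw [← Set.ncard_coe_finset]
    congr 1
    ext x
    simp [signFibre]
  have hgroup : ∑ ε : Fin n → SignType, (signFibre m ε).ncard =
      ∑ S ∈ (Finset.univ : Finset (Fin n)).powerset, 2 ^ S.card * h S.card := by
    simp only [hfib]
    rw [← Finset.sum_fiberwise_of_maps_to (s := Finset.univ)
      (t := (Finset.univ : Finset (Fin n)).powerset)
      (g := fun ε : Fin n → SignType => Finset.univ.filter (fun j => ε j ≠ 0))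
      (fun ε _ => by simp)]
    refine Finset.sum_congr rfl fun S _ => ?_
    rw [← card_sign_vectors_of_support S, ← smul_eq_mul, ← Finset.sum_const]
    exact Finset.sum_congr rfl fun ε hε => by rw [(Finset.mem_filter.1 hε).2]
  rw [hsum, hgroup, Finset.sum_powerset_apply_card (fun c => 2 ^ c * h c), Finset.card_univ,
    Fintype.card_fin, Finset.sum_range_succ']
  simp only [h, smul_eq_mul, Nat.choose_zero_right, pow_zero, one_mul]
  rw [add_comm]
  congr 1
  exact Finset.sum_congr rfl fun k _ => by ring

end

/-! ### The counting formula -/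

theorem image_vertexMaps_crosspolytope {m n : ℕ} (hn : 0 < n) :
    affineMapEquiv m n '' vertexMaps (crosspolytope m) (crosspolytope n) =
      Set.extremePoints ℝ (ballPairs m (Fin n)) := by
  have h := image_vertexMaps (m := m) (Q := crosspolytope n) (convex_convexHull _ _)
  rw [h, crosspolytope_eq hn]
  rfl

theorem corollary6p2 (m n : ℕ) (hm : 2 ≤ m) (hn : 2 ≤ n) :
    (vertexMaps (crosspolytope m) (crosspolytope n)).Finite ∧
    (∀ k ∈ Finset.Icc 4 (min m (n - 1)),
      (vertexMapsOfRank k (crosspolytope m) (cornerSimplex k)).Finite) ∧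
    (vertexMaps (crosspolytope m) (crosspolytope n)).ncard =
      2 ^ m * n ^ m + 2 * n + 2 ^ (m + 1) * (n * (n - 1)) +
        16 * n.choose 4 * signedSurjCount m 3 +
        ∑ k ∈ Finset.Icc 4 (min m (n - 1)),
          2 ^ (k + 1) * n.choose (k + 1) *
            (vertexMapsOfRank k (crosspolytope m) (cornerSimplex k)).ncard := by
  have hm0 : 0 < m := by omega
  have hn0 : 0 < n := by omega
  have himage := image_vertexMaps_crosspolytope (m := m) hn0
  refine ⟨?_, fun k _ => finite_vertexMapsOfRank hm0 k, ?_⟩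
  · refine Set.Finite.of_finite_image ?_ (affineMapEquiv m n).injective.injOn
    rw [himage]
    exact finite_extremePoints_ballPairs m (Fin n)
  · rw [← Set.ncard_image_of_injective _ (affineMapEquiv m n).injective, himage,
      ncard_extremePoints_ballPairs hm0 hn0]
    simp only [ncard_vertexMapsOfRank hm0]
    set F : ℕ → ℕ := fun k =>
      2 ^ (k + 1) * n.choose (k + 1) * (interiorVertices m (Fin (k + 1))).ncard with hF
    have hzero : ∀ k, n ≤ k → F k = 0 := fun k hk => by
      simp [hF, Nat.choose_eq_zero_of_lt (Nat.lt_succ_of_le hk)]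
    -- The range is padded with vanishing terms so that it can be split at `4` even when `n < 4`.
    have e1 : ∑ k ∈ Finset.range n, F k = ∑ k ∈ Finset.range (n + 4), F k := by
      refine Finset.sum_subset (fun k hk => ?_) fun k _ hk => hzero k ?_
      · simp only [Finset.mem_range] at hk ⊢; omega
      · simpa using hk
    have e2 : ∑ k ∈ Finset.range (n + 4), F k =
        ∑ k ∈ Finset.range 4, F k + ∑ k ∈ Finset.Ico 4 (n + 4), F k :=
      (Finset.sum_range_add_sum_Ico F (by omega)).symm
    -- Terms with `k > m` vanish because the rank is at most `m`, those with `k ≥ n` because the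
    -- binomial does.
    have e3 : ∑ k ∈ Finset.Icc 4 (min m (n - 1)), F k = ∑ k ∈ Finset.Ico 4 (n + 4), F k := by
      refine Finset.sum_subset (fun k hk => ?_) fun k hk hk' => ?_
      · simp only [Finset.mem_Icc, Finset.mem_Ico] at hk ⊢; omega
      · simp only [Finset.mem_Icc, Finset.mem_Ico, not_and, not_le] at hk hk'
        rcases min_lt_iff.1 (hk' hk.1) with h | h
        · simp [hF, ncard_interiorVertices_eq_zero hm0 h]
        · exact hzero k (by omega)
    have e4 : ∑ k ∈ Finset.range 4, F k =
        2 * n + 2 ^ (m + 1) * (n * (n - 1)) + 16 * n.choose 4 * signedSurjCount m 3 := by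
      simp only [Finset.sum_range_succ, Finset.sum_range_zero, hF, zero_add]
      rw [ncard_interiorVertices_one, ncard_interiorVertices_two hm0, interiorVertices_three,
        ncard_interiorVertices_four, Nat.choose_one_right, Set.ncard_empty]
      have : n * (n - 1) = 2 * n.choose 2 := by
        rw [Nat.choose_two_right, Nat.mul_div_cancel' (Nat.even_mul_pred_self n).two_dvd]
      rw [this]
      ring
    rw [e1, e2, e4, ← e3, mul_pow]
    ring
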